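/- **Setting.** Programs are classical programs that may call quantum query algorithms (input-independent unitaries alternating with the query unitary $|i\rangle|z\rangle|w\rangle\mapsto|i\rangle|z+x_i\rangle|w\rangle$, with a measurement at the end) as subroutines. The running time is the number of queries. A bound on the running time holds on every execution of positive probability. An *AND-OR-NOT DAG* is a directed acyclic graph $G=(V,E)$, $V=\{v_1,\dots,v_n\}$, $m=|E|$, with no vertex of out-degree $1$. Its sinks are labelled with Boolean variables (several sinks may carry the same variable), every other vertex with a gate $h_i\in\{\mathrm{AND},\mathrm{OR}\}$, and every edge $(v_i,v_j)$ with a bit $\sigma(i,j)$. A root $v_s$ is fixed. Let $\hat n$ be the number of vertices that are not sinks. The value $r_i$ of a sink is the value of its variable; otherwise $r_i=h_i\big(r_{j_1}^{\sigma(i,j_1)},\dots,r_{j_w}^{\sigma(i,j_w)}\big)$, where $D_i=(v_{j_1},\dots,v_{j_w})$ is the list of out-neighbours of $v_i$, $b^1=b$ and $b^0=\neg b$. The number $n$, the out-degrees $d_i=|D_i|$, the gates and the root are known to the algorithm. The entries of the lists $D_i$ (with the edge labels) and the values of the variables at the sinks are accessible only through queries, one query per entry. **Subroutines.** (a) For each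 non-sink $v_i$ and each table $t$ of Boolean values of the non-sinks, $Q_i$ computes $h_i$ on the $d_i$ arguments read off from $D_i$, the labels, the table $t$ and the variables. It makes $O(\sqrt{d_i})$ queries and has one-sided error at most $1/2$: it never errs when the value is the one that means that there is no decisive argument ($1$ for AND, $0$ for OR). (b) For $\hat n\ge 2$, $\mathrm{FirstOneSearch}'(D_i,start)$ returns the least index $z>start$ such that the $z$-th entry of $D_i$ is an unvisited non-sink, or $\mathrm{NULL}$ if there is none. Its error probability is at most $1/\hat n^2$, every index that it returns is $>start$ and points to an unvisited non-sink, and it makes $O(\sqrt{z-start}\,\log\hat n)$ queries if it returns $z$, and $O(\sqrt{d_i-start}\,\log\hat n)$ if it returns $\mathrm{NULL}$. **Algorithm.** *Topological sort* (skipped if $G$ is known to be ordered, that is, $i<j$ for every edge $(v_i,v_j)$ and the sinks come last): start a depth-first search at each not yet visited vertex of a given list that contains all vertices of in-degree $0$. The search at a non-sink $v_i$ marks $v_i$ visited, repeatedly finds the next unvisited non-sink in $D_i$ with $\mathrm{FirstOneSearch}'$ and searches recursively from it, and at the end puts $v_i$ on top of the list $order$. *Evaluation*: go through the non-sinks in the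 order found, from the last back to $v_s$. For each $v_i$ run $Q_i$ a total of $\lceil 2\log_2\hat n\rceil$ times with the values stored so far, and store the result of applying $h_i$ to the outcomes. Return the value stored for $v_s$ (the value of its variable if $v_s$ is a sink). **Theorem.** Subroutines (a) and (b) exist, with universal constants in the $O(\cdot)$. With any such subroutines, for every AND-OR-NOT DAG with $\hat n\ge 2$ and every assignment of its variables, the algorithm computes $r_s$ with running time $O(\sqrt{\hat n m}\,\log\hat n)$, and hence $O(\sqrt{nm}\,\log n)$, and with error probability $O(1/\hat n)$. The constants depend only on the constants in (a) and (b), not on the DAG or the assignment. -/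

import Mathlib

open scoped ENNReal

noncomputable section

/-! ### The quantum query model -/

/-- A quantum query algorithm with query indices `I` and answers in the abelian group `Z`.
The basis states are `|i⟩|z⟩|w⟩` (index, answer and work registers).  The algorithm starts in a basis
state, applies `U 0, query, U 1, query, …, query, U queries`, measures all registers in the
computational basis and outputs a function of the outcome. The unitaries do not depend on the
input. -/
structure QueryAlg (I Z : Type) [Fintype I] [DecidableEq I] [Fintype Z] [DecidableEq Z]
    [AddCommGroup Z] (β : Type) where
  W : Type
  fintypeW : Fintype W
  decEqW : DecidableEq W
  queries : ℕ
  init : I × Z × W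
  U : ℕ → Matrix.unitaryGroup (I × Z × W) ℂ
  out : I × Z × W → β

namespace QueryAlg

attribute [instance] QueryAlg.fintypeW QueryAlg.decEqW

variable {I Z : Type} [Fintype I] [DecidableEq I] [Fintype Z] [DecidableEq Z] [AddCommGroup Z]
  {β : Type}

/-- The query unitary `|i⟩|z⟩|w⟩ ↦ |i⟩|z + x i⟩|w⟩`, acting on amplitude vectors. -/
def queryOp {W : Type} (x : I → Z) (ψ : I × Z × W → ℂ) : I × Z × W → ℂ :=
  fun b => ψ (b.1, b.2.1 - x b.1, b.2.2)

/-- The state after `t` queries (and the unitary that follows the last of them). -/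
def state (A : QueryAlg I Z β) (x : I → Z) : ℕ → (I × Z × A.W → ℂ)
  | 0 => (A.U 0).1.mulVec (Pi.single A.init 1)
  | t + 1 => (A.U (t + 1)).1.mulVec (queryOp x (A.state x t))

theorem sum_normSq_mulVec {B : Type} [Fintype B] [DecidableEq B]
    (U : Matrix.unitaryGroup B ℂ) (ψ : B → ℂ) :
    ∑ b, ‖U.1.mulVec ψ b‖ ^ 2 = ∑ b, ‖ψ b‖ ^ 2 := by
  have key : ∀ φ : B → ℂ, ((∑ b, ‖φ b‖ ^ 2 : ℝ) : ℂ) = dotProduct (star φ) φ := by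
    intro φ
    simp only [dotProduct, Pi.star_apply, RCLike.star_def, Complex.ofReal_sum]
    refine Finset.sum_congr rfl fun b _ => ?_
    rw [mul_comm, Complex.mul_conj, Complex.normSq_eq_norm_sq]
  have hU : (U.1).conjTranspose * U.1 = 1 := by
    have := Matrix.UnitaryGroup.star_mul_self U
    simpa [Matrix.star_eq_conjTranspose] using this
  have h : ((∑ b, ‖U.1.mulVec ψ b‖ ^ 2 : ℝ) : ℂ) = ((∑ b, ‖ψ b‖ ^ 2 : ℝ) : ℂ) := by
    rw [key, key, Matrix.star_mulVec, Matrix.dotProduct_mulVec, Matrix.vecMul_vecMul, hU,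
      Matrix.vecMul_one]
  exact_mod_cast h

theorem sum_normSq_queryOp {W : Type} [Fintype W] (x : I → Z) (ψ : I × Z × W → ℂ) :
    ∑ b, ‖queryOp x ψ b‖ ^ 2 = ∑ b, ‖ψ b‖ ^ 2 := by
  simp only [queryOp, Fintype.sum_prod_type]
  refine Finset.sum_congr rfl fun i _ => ?_
  exact Equiv.sum_comp (Equiv.subRight (x i)) (fun z => ∑ w, ‖ψ (i, z, w)‖ ^ 2)

theorem sum_normSq_state (A : QueryAlg I Z β) (x : I → Z) (t : ℕ) :
    ∑ b, ‖A.state x t b‖ ^ 2 = 1 := by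
  induction t with
  | zero =>
    rw [state, sum_normSq_mulVec, Finset.sum_eq_single A.init]
    · simp
    · intro b _ hb
      simp [hb]
    · simp
  | succ t ih => rw [state, sum_normSq_mulVec, sum_normSq_queryOp, ih]

/-- The distribution of the output: measure the final state, then apply `out`. -/
def output (A : QueryAlg I Z β) (x : I → Z) : PMF β :=
  (PMF.ofFintype (fun b => ENNReal.ofReal (‖A.state x A.queries b‖ ^ 2)) (by
    rw [← ENNReal.ofReal_sum_of_nonneg fun b _ => sq_nonneg _, sum_normSq_state,
      ENNReal.ofReal_one])).map A.out

end QueryAlg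

/-- Classical programs that use quantum query algorithms as subroutines. -/
inductive QProg (I Z : Type) [Fintype I] [DecidableEq I] [Fintype Z] [DecidableEq Z]
    [AddCommGroup Z] (α : Type) : Type 1 where
  | done (a : α) : QProg I Z α
  | call {β : Type} (A : QueryAlg I Z β) (k : β → QProg I Z α) : QProg I Z α

namespace QProg

variable {I Z : Type} [Fintype I] [DecidableEq I] [Fintype Z] [DecidableEq Z] [AddCommGroup Z]

/-- Sequential composition of programs. -/
def seq {α γ : Type} : QProg I Z α → (α → QProg I Z γ) → QProg I Z γ
  | done a, f => f a
  | call A k, f => call A fun b => (k b).seq f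

instance : Monad (QProg I Z) where
  pure := done
  bind := seq

/-- Run a program on the input `x`: the joint distribution of the result and of the number of
queries. -/
def run {α : Type} (x : I → Z) : QProg I Z α → PMF (α × ℕ)
  | done a => PMF.pure (a, 0)
  | call A k => (A.output x).bind fun b => ((k b).run x).map fun p => (p.1, A.queries + p.2)

/-- The probability that the result differs from `a`. -/
def errorProb {α : Type} (P : QProg I Z α) (x : I → Z) (a : α) : ℝ≥0∞ :=
  ((P.run x).map Prod.fst).toOuterMeasure {b | b ≠ a}

/-- Read one entry of the input classically, with one query. -/
def read (i : I) : QProg I Z Z :=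
  call (β := Z)
    { W := Unit
      fintypeW := inferInstance
      decEqW := inferInstance
      queries := 1
      init := (i, 0, ())
      U := fun _ => 1
      out := fun b => b.2.1 } done

/-- Run `P` a total of `k` times and collect the results. -/
def replicate {α : Type} (P : QProg I Z α) : ℕ → QProg I Z (List α)
  | 0 => pure []
  | k + 1 => do
    let a ← P
    let l ← replicate P k
    pure (a :: l)

end QProg

/-! ### AND-OR-NOT DAGs -/

inductive Gate where
  | conj
  | disj

namespace Gate

/-- The value of a gate on a list of arguments. -/
def eval : Gate → List Bool → Bool
  | conj, l => l.all id
  | disj, l => l.any id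

/-- The value taken by a gate when a search for a decisive argument finds nothing. -/
def neutral : Gate → Bool
  | conj => true
  | disj => false

end Gate

/-- The part of an AND-OR-NOT DAG that is known to the algorithm without queries: the vertices
`Fin n`, their out-degrees, the gates of the vertices with positive out-degree, the root. -/
structure Frame (n : ℕ) where
  deg : Fin n → ℕ
  gate : {v : Fin n // deg v ≠ 0} → Gate
  root : Fin n

namespace Frame

variable {n : ℕ} (F : Frame n)

/-- The number of vertices that are not sinks. -/
def nhat : ℕ := (Finset.univ.filter fun v => F.deg v ≠ 0).card

/-- What can be queried: the entries of the adjacency lists, and the values of the variables at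
the sinks. -/
abbrev Index : Type := (Σ v : Fin n, Fin (F.deg v)) ⊕ {v : Fin n // F.deg v = 0}

/-- Answers: a vertex number modulo `n` together with a bit modulo 2. -/
abbrev Answer (n : ℕ) : Type := Fin n × ZMod 2

/-- Programs with query access to the adjacency lists and the variables. -/
abbrev Prog [NeZero n] (α : Type) : Type 1 := QProg F.Index (Answer n) α

end Frame

/-- A bit as an element of `ZMod 2`. -/
def bit (b : Bool) : ZMod 2 := if b then 1 else 0

/-- An AND-OR-NOT DAG with `n` vertices over `N` variables, in the adjacency list model.
`adj v` is the list of the out-neighbours of `v`, and `label v z` is the label of the edge from `v`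
to `adj v z`. -/
structure AndOrNotDag (n N : ℕ) extends Frame n where
  adj : (v : Fin n) → Fin (deg v) → Fin n
  adj_injective : ∀ v, Function.Injective (adj v)
  label : (v : Fin n) → Fin (deg v) → Bool
  var : {v : Fin n // deg v = 0} → Fin N
  deg_ne_one : ∀ v, deg v ≠ 1
  acyclic : ∀ v, ¬ Relation.TransGen (fun u w => ∃ z, adj u z = w) v v

namespace AndOrNotDag

variable {n N : ℕ} (G : AndOrNotDag n N)

def Edge (u w : Fin n) : Prop := ∃ z, G.adj u z = w

/-- The number of edges. -/
def edgeCount : ℕ := Set.ncard {e : Fin n × Fin n | G.Edge e.1 e.2}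

def IsSource (w : Fin n) : Prop := ∀ u, ¬ G.Edge u w

/-- Edges lead from smaller to larger vertex numbers, and the sinks come last. -/
def IsOrdered : Prop :=
  (∀ u w, G.Edge u w → u < w) ∧ ∀ v : Fin n, G.nhat ≤ (v : ℕ) → G.deg v = 0

theorem wellFounded_edge : WellFounded fun w u => G.Edge u w := by
  let r : Fin n → Fin n → Prop := fun w u => Relation.TransGen G.Edge u w
  have : IsTrans (Fin n) r := ⟨fun _ _ _ h₁ h₂ => Relation.TransGen.trans h₂ h₁⟩
  have : Std.Irrefl r := ⟨fun v h => G.acyclic v h⟩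
  have h : WellFounded r := Finite.wellFounded_of_trans_of_irrefl r
  exact Subrelation.wf (fun h' => Relation.TransGen.single h') h

/-- The values `r v` of the vertices on the input `x`. The factor `b ^ σ` is `b == σ`, which is
`b` for `σ = 1` and `¬ b` for `σ = 0`. -/
def value (x : Fin N → Bool) : Fin n → Bool :=
  G.wellFounded_edge.fix fun v r =>
    if h : G.deg v = 0 then x (G.var ⟨v, h⟩)
    else (G.gate ⟨v, h⟩).eval (List.ofFn fun z => r (G.adj v z) ⟨z, rfl⟩ == G.label v z)

theorem value_eq (x : Fin N → Bool) (v : Fin n) :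
    G.value x v = if h : G.deg v = 0 then x (G.var ⟨v, h⟩)
      else (G.gate ⟨v, h⟩).eval
        (List.ofFn fun z => G.value x (G.adj v z) == G.label v z) := by
  rw [value, WellFounded.fix_eq]

/-- The input that the algorithm can query. -/
def oracle [NeZero n] (x : Fin N → Bool) : G.Index → Frame.Answer n
  | Sum.inl ⟨v, z⟩ => (G.adj v z, bit (G.label v z))
  | Sum.inr s => (0, bit (x (G.var s)))

/-- The argument number `z` of the gate at `v`, when `t` stores the values of the vertices that
are not sinks. -/
def arg (x : Fin N → Bool) (t : Fin n → Bool) (v : Fin n) (z : Fin (G.deg v)) : Bool :=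
  (if h : G.deg (G.adj v z) = 0 then x (G.var ⟨G.adj v z, h⟩) else t (G.adj v z)) == G.label v z

/-- A position of the adjacency list of `v` that holds a vertex which is neither visited nor a
sink. -/
def Fresh (visited : Fin n → Bool) (v : Fin n) (z : Fin (G.deg v)) : Prop :=
  visited (G.adj v z) = false ∧ G.deg (G.adj v z) ≠ 0

open scoped Classical in
/-- The first such position that is at least `start`, if there is one. -/
def firstFresh (visited : Fin n → Bool) (v : Fin n) (start : ℕ) : Option (Fin (G.deg v)) :=
  (List.finRange (G.deg v)).find? fun z => decide (start ≤ (z : ℕ) ∧ G.Fresh visited v z)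

end AndOrNotDag

/-! ### The algorithm -/

/-- The two search subroutines.  Their code may depend on what is known without queries and on
the classical memory.  Positions in adjacency lists are counted from 0, and `firstOne F visited v start`
searches the positions `start, start + 1, …`. -/
structure Subroutines where
  gate : {n : ℕ} → [NeZero n] → (F : Frame n) → (t : Fin n → Bool) → (v : Fin n) → F.Prog Bool
  firstOne : {n : ℕ} → [NeZero n] → (F : Frame n) → (visited : Fin n → Bool) → (v : Fin n) →
    (start : ℕ) → F.Prog (Option (Fin (F.deg v)))

/-- `gate` evaluates a gate with `d` arguments with at most `C * √d` queries and with one-sided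
error at most `1/2`.  `firstOne` finds the first fresh position with error at most `1/nhat²`; it
only ever reports fresh positions; if it reports the `l`-th of the positions searched, it has made at most
`C * √l * log nhat` queries, and if it reports that there is none among `l` positions, likewise. -/
structure Subroutines.Correct (S : Subroutines) (C : ℝ) : Prop where
  gate_queries : ∀ {n N : ℕ} [NeZero n] (G : AndOrNotDag n N) (x : Fin N → Bool)
    (t : Fin n → Bool) (v : Fin n), G.deg v ≠ 0 →
    ∀ p ∈ ((S.gate G.toFrame t v).run (G.oracle x)).support, (p.2 : ℝ) ≤ C * √(G.deg v)
  gate_error : ∀ {n N : ℕ} [NeZero n] (G : AndOrNotDag n N) (x : Fin N → Bool)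
    (t : Fin n → Bool) (v : Fin n) (hv : G.deg v ≠ 0),
    (S.gate G.toFrame t v).errorProb (G.oracle x)
      ((G.gate ⟨v, hv⟩).eval (List.ofFn (G.arg x t v))) ≤ 1 / 2
  gate_one_sided : ∀ {n N : ℕ} [NeZero n] (G : AndOrNotDag n N) (x : Fin N → Bool)
    (t : Fin n → Bool) (v : Fin n) (hv : G.deg v ≠ 0),
    (G.gate ⟨v, hv⟩).eval (List.ofFn (G.arg x t v)) = (G.gate ⟨v, hv⟩).neutral →
    (S.gate G.toFrame t v).errorProb (G.oracle x) (G.gate ⟨v, hv⟩).neutral = 0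
  first_found : ∀ {n N : ℕ} [NeZero n] (G : AndOrNotDag n N) (x : Fin N → Bool)
    (visited : Fin n → Bool) (v : Fin n) (start : ℕ), 2 ≤ G.nhat → start ≤ G.deg v →
    ∀ z q, (some z, q) ∈ ((S.firstOne G.toFrame visited v start).run (G.oracle x)).support →
      start ≤ (z : ℕ) ∧ G.Fresh visited v z ∧
        (q : ℝ) ≤ C * √((z : ℝ) + 1 - start) * Real.log G.nhat
  first_none : ∀ {n N : ℕ} [NeZero n] (G : AndOrNotDag n N) (x : Fin N → Bool)
    (visited : Fin n → Bool) (v : Fin n) (start : ℕ), 2 ≤ G.nhat → start ≤ G.deg v →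
    ∀ q, (none, q) ∈ ((S.firstOne G.toFrame visited v start).run (G.oracle x)).support →
      (q : ℝ) ≤ C * √((G.deg v : ℝ) - start) * Real.log G.nhat
  first_error : ∀ {n N : ℕ} [NeZero n] (G : AndOrNotDag n N) (x : Fin N → Bool)
    (visited : Fin n → Bool) (v : Fin n) (start : ℕ), 2 ≤ G.nhat → start ≤ G.deg v →
    (S.firstOne G.toFrame visited v start).errorProb (G.oracle x) (G.firstFresh visited v start) ≤
      ENNReal.ofReal (1 / (G.nhat : ℝ) ^ 2)

namespace Subroutines

variable {n : ℕ} [NeZero n] (S : Subroutines) (F : Frame n)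

/-- The memory of the depth-first search. -/
structure Memory (n : ℕ) where
  visited : Fin n → Bool
  order : List (Fin n)

/-- The loop over the adjacency list of `v`: find the next fresh neighbour, apply `visit` to it, and
continue behind it.  The first numeral bounds the number of rounds. -/
def scan (visit : Fin n → Memory n → F.Prog (Memory n)) (v : Fin n) :
    ℕ → ℕ → Memory n → F.Prog (Memory n)
  | 0, _, s => pure s
  | rounds + 1, start, s => do
    match ← S.firstOne F s.visited v start with
    | none => pure s
    | some z => do
      let a ← QProg.read (I := F.Index) (Z := Frame.Answer n) (Sum.inl ⟨v, z⟩)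
      let s' ← visit a.1 s
      scan visit v rounds ((z : ℕ) + 1) s'

/-- The depth-first search of the topological sort.  The first argument bounds the depth. -/
def topSortDFS : ℕ → Fin n → Memory n → F.Prog (Memory n)
  | 0, _, s => pure s
  | depth + 1, v, s => do
    let s₁ : Memory n := { s with visited := Function.update s.visited v true }
    if F.deg v = 0 then pure s₁
    else do
      let s₂ ← S.scan F (topSortDFS depth) v (F.deg v + 1) 0 s₁
      pure { s₂ with order := v :: s₂.order }

/-- The topological sort of the vertices that are not sinks. The search is started at each
vertex in `starts` that has not been visited before. -/
def topSort (starts : List (Fin n)) : F.Prog (List (Fin n)) := do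
  let s ← starts.foldlM (init := (⟨fun _ => false, []⟩ : Memory n)) fun s v =>
    if s.visited v then (pure s : F.Prog (Memory n)) else S.topSortDFS F n v s
  pure s.order

/-- Apply the gate to the results of `⌈2 log₂ nhat⌉` runs of the gate subroutine. -/
def boostedGate (t : Fin n → Bool) (v : {v : Fin n // F.deg v ≠ 0}) : F.Prog Bool := do
  let l ← (S.gate F t v.1).replicate ⌈2 * Real.logb 2 F.nhat⌉₊
  pure ((F.gate v).eval l)

/-- The evaluation of an AND-OR-NOT DAG.  The topological sort is left out if `ordered` is `true`.
The vertices that are not sinks are treated from the last one back to the root. -/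
def evaluate (ordered : Bool) (starts : List (Fin n)) : F.Prog Bool := do
  let order ← if ordered then
      (pure ((List.finRange n).filter fun v => F.deg v ≠ 0) : F.Prog (List (Fin n)))
    else S.topSort F starts
  let t ← ((order.dropWhile fun v => v ≠ F.root).reverse).foldlM
    (init := (fun _ => false : Fin n → Bool)) fun t v =>
      if h : F.deg v ≠ 0 then do
        let b ← S.boostedGate F t ⟨v, h⟩
        pure (Function.update t v b)
      else (pure t : F.Prog (Fin n → Bool))
  if h : F.deg F.root = 0 then do
    let a ← QProg.read (I := F.Index) (Z := Frame.Answer n) (Sum.inr ⟨F.root, h⟩)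
    pure (a.2 == 1)
  else pure (t F.root)

end Subroutines

end

/-!
Existence of the subroutines rests on Grover search. In the span of the basis states that stand
for the positions of an adjacency list, one iteration takes four queries: two compute the entry
and, if it points to a sink, the variable there, and two erase these answers; an input-independent
reflection follows. The state is a rotation by twice `groverAngle` in the plane of the marked and
the unmarked positions (`evolve_grover`, `groverAmp_succ`). No random choice of the number of
iterations is needed although the number of marked positions is unknown: along `0, 1, 2, 4, …` the
angle at most triples, so that one of these numbers leads to an angle between `π/4` and `3π/4`
(`exists_sin_sq_ge`). Since every outcome is checked classically, errors are one-sided, and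
repetition makes the error exponentially small (`errorProb_detect_true`,
`errorProb_detect_false`).

The gate subroutine is one such search for a decisive argument. The first fresh position is found
by a search of disjoint blocks of lengths `1, 2, 4, …`, followed by a binary search in the block
that is hit (`always_blockSearch`, `errorProb_blockSearch`). An empty block cannot cause an error,
and the binary search repeats its steps more often on shorter intervals; therefore the logarithm
of the length of the list, which is not bounded in terms of the number of vertices that are not
sinks, enters neither the error nor the cost.

For the analysis of the algorithm with arbitrary correct subroutines, `√l` is replaced by its
tangent `lam / 2 * l + 1 / (2 * lam)` with `lam = √(nhat / m)`. Costs then are linear in the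
lengths of the intervals searched and in the number of searches, and are charged to the visited
vertices, on all executions (`always_topSort`): the intervals searched at a vertex add up to its
out-degree, and each successful search visits a new vertex. The sums of the tangents over all
vertices that are not sinks are `√(nhat m)`.

The error is bounded along the one execution on which every subroutine succeeds. On it, an active
vertex of the depth-first search is an ancestor of the current one, so that by acyclicity all
non-sink out-neighbours of a vertex precede it in postorder (`exists_errorProb_topSortDFS`), and
the evaluation meets only gates whose arguments are correct (`exists_errorProb_evalLoop`). There are
at most `2 nhat` searches and `nhat` gates, each of which fails with probability at most
`1 / nhat²`.
-/

noncomputable section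

/-! ### Reasoning about programs -/

namespace QProg

variable {I Z : Type} [Fintype I] [DecidableEq I] [Fintype Z] [DecidableEq Z] [AddCommGroup Z]
  {α γ : Type}

theorem pure_eq_done (a : α) : (pure a : QProg I Z α) = done a := rfl

theorem bind_eq_seq (P : QProg I Z α) (f : α → QProg I Z γ) : P >>= f = P.seq f := rfl

theorem seq_done (P : QProg I Z α) : P.seq done = P := by
  induction P with
  | done a => rfl
  | call A k ih => simp only [seq, ih]

theorem seq_assoc {δ : Type} (P : QProg I Z α) (f : α → QProg I Z γ) (g : γ → QProg I Z δ) :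
    (P.seq f).seq g = P.seq fun a => (f a).seq g := by
  induction P with
  | done a => rfl
  | call A k ih => simp only [seq, ih]

instance : LawfulMonad (QProg I Z) :=
  LawfulMonad.mk' (m := QProg I Z)
    (id_map := fun P => seq_done P)
    (pure_bind := fun _ _ => rfl)
    (bind_assoc := fun P f g => seq_assoc P f g)

theorem run_bind (x : I → Z) (P : QProg I Z α) (f : α → QProg I Z γ) :
    (P >>= f).run x =
      (P.run x).bind fun p => ((f p.1).run x).map fun q => (q.1, p.2 + q.2) := by
  rw [bind_eq_seq]
  induction P with
  | done a =>
    simp only [seq, run, PMF.pure_bind, zero_add]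
    exact (PMF.map_id _).symm
  | call A k ih =>
    simp only [seq, run, ih, PMF.bind_bind, PMF.map_bind, PMF.bind_map, PMF.map_comp,
      Function.comp_def, add_assoc]

/-- Every execution of positive probability ends with a result `a` after `q` queries such that
`Q a q`. -/
def Always (P : QProg I Z α) (x : I → Z) (Q : α → ℕ → Prop) : Prop :=
  ∀ p ∈ (P.run x).support, Q p.1 p.2

theorem Always.mono {P : QProg I Z α} {x : I → Z} {Q R : α → ℕ → Prop} (h : P.Always x Q)
    (hQR : ∀ a q, Q a q → R a q) : P.Always x R :=
  fun p hp => hQR _ _ (h p hp)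

theorem Always.and {P : QProg I Z α} {x : I → Z} {Q R : α → ℕ → Prop} (h : P.Always x Q)
    (h' : P.Always x R) : P.Always x fun a q => Q a q ∧ R a q :=
  fun p hp => ⟨h p hp, h' p hp⟩

theorem always_pure {x : I → Z} {a : α} {Q : α → ℕ → Prop} :
    (pure a : QProg I Z α).Always x Q ↔ Q a 0 := by
  simp [Always, pure_eq_done, run]

theorem always_bind {x : I → Z} {P : QProg I Z α} {f : α → QProg I Z γ} {Q : γ → ℕ → Prop} :
    (P >>= f).Always x Q ↔
      P.Always x fun a q => (f a).Always x fun b q' => Q b (q + q') := by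
  simp only [Always, run_bind, PMF.mem_support_bind_iff, PMF.mem_support_map_iff]
  constructor
  · intro h p hp r hr
    exact h (r.1, p.2 + r.2) ⟨p, hp, r, hr, rfl⟩
  · rintro h _ ⟨p, hp, r, hr, rfl⟩
    exact h p hp r hr

theorem always_call {β : Type} {A : QueryAlg I Z β} {k : β → QProg I Z α} {x : I → Z}
    {Q : α → ℕ → Prop} (h : ∀ b, (k b).Always x fun a q => Q a (A.queries + q)) :
    (call A k).Always x Q := by
  intro p hp
  simp only [run, PMF.mem_support_bind_iff, PMF.mem_support_map_iff] at hp
  obtain ⟨b, _, r, hr, rfl⟩ := hp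
  exact h b r hr

/-- The distribution of the result of a program. -/
def dist (P : QProg I Z α) (x : I → Z) : PMF α := (P.run x).map Prod.fst

theorem errorProb_eq (P : QProg I Z α) (x : I → Z) (a : α) :
    P.errorProb x a = (P.dist x).toOuterMeasure {b | b ≠ a} := rfl

theorem dist_pure (x : I → Z) (a : α) : (pure a : QProg I Z α).dist x = PMF.pure a := by
  simp [dist, pure_eq_done, run, PMF.pure_map]

theorem dist_bind (x : I → Z) (P : QProg I Z α) (f : α → QProg I Z γ) :
    (P >>= f).dist x = (P.dist x).bind fun a => (f a).dist x := by
  simp only [dist, run_bind, PMF.map_bind, PMF.bind_map, PMF.map_comp, Function.comp_def]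

theorem dist_call {β : Type} (x : I → Z) (A : QueryAlg I Z β) (k : β → QProg I Z α) :
    (call A k).dist x = (A.output x).bind fun b => (k b).dist x := by
  simp only [dist, run, PMF.map_bind, PMF.map_comp, Function.comp_def]

theorem errorProb_le_one (P : QProg I Z α) (x : I → Z) (a : α) : P.errorProb x a ≤ 1 := by
  rw [errorProb_eq]
  rw [PMF.toOuterMeasure_apply, ← (P.dist x).tsum_coe]
  exact ENNReal.tsum_le_tsum fun b => Set.indicator_le_self _ _ _

theorem errorProb_pure (x : I → Z) (a : α) : (pure a : QProg I Z α).errorProb x a = 0 := by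
  rw [errorProb_eq, dist_pure, PMF.toOuterMeasure_pure_apply]
  simp

theorem errorProb_eq_zero_iff {P : QProg I Z α} {x : I → Z} {a : α} :
    P.errorProb x a = 0 ↔ P.Always x fun b _ => b = a := by
  rw [errorProb_eq, PMF.toOuterMeasure_apply_eq_zero_iff, Set.disjoint_left]
  simp only [dist, Always]
  constructor
  · intro h p hp
    have := h ((PMF.mem_support_map_iff _ _ _).2 ⟨p, hp, rfl⟩)
    simpa using this
  · intro h b hb
    obtain ⟨p, hp, rfl⟩ := (PMF.mem_support_map_iff _ _ _).1 hb
    simpa using h p hp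

theorem errorProb_bind (x : I → Z) (P : QProg I Z α) (f : α → QProg I Z γ) (b : γ) :
    (P >>= f).errorProb x b = ∑' a, P.dist x a * (f a).errorProb x b := by
  simp only [errorProb_eq, dist_bind, PMF.toOuterMeasure_bind_apply]

/-- The union bound for a sequential composition whose first part has one intended result. -/
theorem errorProb_bind_le {x : I → Z} {P : QProg I Z α} {f : α → QProg I Z γ} {a : α} {b : γ}
    {ε δ : ℝ≥0∞} (hP : P.errorProb x a ≤ ε) (hf : (f a).errorProb x b ≤ δ) :
    (P >>= f).errorProb x b ≤ ε + δ := by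
  classical
  rw [errorProb_bind]
  calc ∑' c, P.dist x c * (f c).errorProb x b
      ≤ ∑' c, (Set.indicator {c | c ≠ a} (P.dist x) c + P.dist x c * δ) := by
        refine ENNReal.tsum_le_tsum fun c => ?_
        by_cases hc : c = a
        · subst hc
          exact le_add_left (mul_le_mul_right hf _)
        · rw [Set.indicator_of_mem (by simpa using hc)]
          exact le_add_right ((mul_le_mul_right (errorProb_le_one _ _ _) _).trans_eq (mul_one _))
    _ = P.errorProb x a + δ := by
        rw [ENNReal.tsum_add, ENNReal.tsum_mul_right, PMF.tsum_coe, one_mul, errorProb_eq,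
          PMF.toOuterMeasure_apply]
    _ ≤ ε + δ := by gcongr

theorem run_read (x : I → Z) (i : I) : (read i : QProg I Z Z).run x = PMF.pure (x i, 1) := by
  have hstate : ∀ b : I × Z × Unit,
      QueryAlg.queryOp x (Pi.single (i, (0 : Z), ()) (1 : ℂ)) b =
        (Pi.single (i, x i, ()) 1 : I × Z × Unit → ℂ) b := by
    rintro ⟨j, z, ⟨⟩⟩
    simp only [QueryAlg.queryOp, Pi.single_apply, Prod.mk.injEq, and_true]
    refine if_congr ?_ rfl rfl
    constructor
    · rintro ⟨rfl, h⟩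
      exact ⟨rfl, sub_eq_zero.1 h⟩
    · rintro ⟨rfl, rfl⟩
      exact ⟨rfl, sub_self _⟩
  simp only [read, run, QueryAlg.output, PMF.bind_map, Function.comp_def, PMF.pure_map, add_zero]
  rw [show (fun b : I × Z × Unit => PMF.pure (b.2.1, 1)) = PMF.pure ∘ fun b => (b.2.1, 1) from rfl,
    PMF.bind_pure_comp]
  have : ∀ p : PMF (I × Z × Unit), p = PMF.pure (i, x i, ()) →
      p.map (fun b => (b.2.1, 1)) = PMF.pure (x i, 1) := by
    rintro _ rfl
    simp [PMF.pure_map]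
  apply this
  ext b
  rw [PMF.ofFintype_apply]
  simp only [QueryAlg.state, Matrix.one_mulVec, OneMemClass.coe_one, hstate, PMF.pure_apply,
    Pi.single_apply]
  split_ifs <;> simp

theorem always_read {x : I → Z} {i : I} {Q : Z → ℕ → Prop} :
    (read i : QProg I Z Z).Always x Q ↔ Q (x i) 1 := by
  simp [Always, run_read]

theorem errorProb_read (x : I → Z) (i : I) : (read i : QProg I Z Z).errorProb x (x i) = 0 := by
  rw [errorProb_eq_zero_iff, always_read]

end QProg

/-! ### Unitaries for amplitude amplification -/

section Unitaries

variable {B D : Type} [Fintype B] [DecidableEq B] [Fintype D]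

/-- The Householder reflection `1 - 2 w w* / (w* w)` (the identity if `w = 0`). -/
def householder (w : B → ℂ) : Matrix.unitaryGroup B ℂ :=
  ⟨1 - (2 / (star w ⬝ᵥ w)) • Matrix.vecMulVec w (star w), by
    have hc : star (star w ⬝ᵥ w) = star w ⬝ᵥ w := by
      rw [← Matrix.star_dotProduct_star, star_star]
    have hs : star (1 - (2 / (star w ⬝ᵥ w)) • Matrix.vecMulVec w (star w)) =
        1 - (2 / (star w ⬝ᵥ w)) • Matrix.vecMulVec w (star w) := by
      rw [star_sub, star_one, star_smul, star_div₀, hc, Matrix.star_eq_conjTranspose,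
        Matrix.conjTranspose_vecMulVec, star_star]
      simp
    have hsq : Matrix.vecMulVec w (star w) * Matrix.vecMulVec w (star w) =
        (star w ⬝ᵥ w) • Matrix.vecMulVec w (star w) := by
      rw [Matrix.vecMulVec_mul_vecMulVec]
      ext i j
      simp [Matrix.vecMulVec_apply]
      ring
    rw [Matrix.mem_unitaryGroup_iff', hs]
    generalize star w ⬝ᵥ w = c at hsq ⊢
    generalize Matrix.vecMulVec w (star w) = V at hsq ⊢
    have h2 : (2 / c) * ((2 / c) * c) = 2 / c + 2 / c := by
      rcases eq_or_ne c 0 with rfl | h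
      · simp
      · field_simp
        norm_num
    rw [sub_mul, mul_sub, mul_sub, smul_mul_smul_comm, hsq, smul_smul, mul_assoc, h2, add_smul]
    simp⟩

theorem householder_mulVec (w ψ : B → ℂ) :
    (householder w).1.mulVec ψ = ψ - (2 / (star w ⬝ᵥ w) * (star w ⬝ᵥ ψ)) • w := by
  ext b
  simp [householder, Matrix.sub_mulVec, Matrix.smul_mulVec, Matrix.vecMulVec_mulVec]
  ring

/-- The basis permutation `π`, with the sign `-1` on the basis states `b` with `φ b = false`. -/
def signedPerm (π : Equiv.Perm B) (φ : B → Bool) : Matrix.unitaryGroup B ℂ :=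
  ⟨Matrix.of fun b c => if b = π c then (if φ c then 1 else -1) else 0, by
    rw [Matrix.mem_unitaryGroup_iff']
    ext b c
    simp only [Matrix.mul_apply, Matrix.star_apply, Matrix.of_apply, Matrix.one_apply]
    rw [Finset.sum_eq_single (π b) (by intro a _ ha; simp [ha]) (by simp)]
    by_cases h : b = c
    · subst h
      by_cases hb : φ b <;> simp [hb]
    · simp [h]⟩

/-- The superposition of the basis states `h z` with real amplitudes `α z`. -/
def superpose (h : D → B) (α : D → ℝ) : B → ℂ :=
  ∑ z, (α z : ℂ) • Pi.single (h z) 1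

theorem signedPerm_mulVec_superpose (π : Equiv.Perm B) (φ : B → Bool) (h : D → B) (α : D → ℝ) :
    (signedPerm π φ).1.mulVec (superpose h α) =
      superpose (fun z => π (h z)) fun z => if φ (h z) then α z else -α z := by
  simp only [superpose, Matrix.mulVec_sum, Matrix.mulVec_smul]
  refine Finset.sum_congr rfl fun z _ => ?_
  ext b
  simp only [signedPerm, Matrix.mulVec_single_one, Matrix.col_apply, Pi.smul_apply,
    Matrix.of_apply, Pi.single_apply, smul_eq_mul]
  split_ifs <;> simp

omit [Fintype B] in
theorem superpose_apply [DecidableEq D] {h : D → B} (hh : Function.Injective h) (α : D → ℝ)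
    (z : D) : superpose h α (h z) = α z := by
  simp only [superpose, Finset.sum_apply, Pi.smul_apply, smul_eq_mul]
  rw [Finset.sum_eq_single z]
  · simp
  · intro y _ hy
    rw [Pi.single_eq_of_ne (fun hzy => hy (hh hzy).symm), mul_zero]
  · simp

theorem star_superpose_dotProduct [DecidableEq D] {h : D → B} (hh : Function.Injective h)
    (α β : D → ℝ) : star (superpose h β) ⬝ᵥ superpose h α = ((∑ z, β z * α z : ℝ) : ℂ) := by
  conv_lhs => rw [superpose, star_sum, sum_dotProduct]
  push_cast
  refine Finset.sum_congr rfl fun z _ => ?_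
  rw [star_smul, smul_dotProduct, ← Pi.single_star, star_one, single_one_dotProduct,
    superpose_apply hh]
  simp

theorem householder_mulVec_superpose [DecidableEq D] {h : D → B} (hh : Function.Injective h)
    (α β : D → ℝ) :
    (householder (superpose h β)).1.mulVec (superpose h α) =
      superpose h fun z => α z - 2 / (∑ y, β y * β y) * (∑ y, β y * α y) * β z := by
  rw [householder_mulVec, star_superpose_dotProduct hh, star_superpose_dotProduct hh]
  simp only [superpose, Finset.smul_sum, smul_smul, ← Finset.sum_sub_distrib, ← sub_smul]
  push_cast
  rfl

end Unitaries

theorem queryOp_superpose {I Z W D : Type} [Fintype I] [DecidableEq I] [Fintype Z] [DecidableEq Z]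
    [AddCommGroup Z] [Fintype W] [DecidableEq W] [Fintype D] (x : I → Z) (h : D → I × Z × W)
    (α : D → ℝ) :
    QueryAlg.queryOp x (superpose h α) =
      superpose (fun z => ((h z).1, (h z).2.1 + x (h z).1, (h z).2.2)) α := by
  ext ⟨i, a, w⟩
  simp only [QueryAlg.queryOp, superpose, Finset.sum_apply, Pi.smul_apply, Pi.single_apply]
  refine Finset.sum_congr rfl fun z _ => ?_
  congr 1
  refine if_congr ?_ rfl rfl
  rcases h z with ⟨j, c, v⟩
  simp only [Prod.mk.injEq]
  constructor
  · rintro ⟨rfl, h, rfl⟩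
    exact ⟨rfl, by rw [← h, sub_add_cancel], rfl⟩
  · rintro ⟨rfl, rfl, rfl⟩
    exact ⟨rfl, add_sub_cancel_right _ _, rfl⟩

/-! ### The amplitudes of Grover's algorithm -/

section Amplitudes

variable {D : Type} [Fintype D] (marked : D → Bool)

/-- Half the angle by which one Grover iteration rotates the state. -/
def groverAngle : ℝ :=
  Real.arcsin (√((Finset.univ.filter fun z => marked z = true).card : ℝ) / √(Fintype.card D))

/-- The amplitudes after `T` Grover iterations. A denominator vanishes only in the branch that no
position takes. -/
def groverAmp (T : ℕ) (z : D) : ℝ :=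
  if marked z then
    Real.sin ((2 * T + 1) * groverAngle marked) /
      √((Finset.univ.filter fun z => marked z = true).card : ℝ)
  else
    Real.cos ((2 * T + 1) * groverAngle marked) /
      √((Finset.univ.filter fun z => ¬ marked z = true).card : ℝ)

theorem sq_add_sq_card :
    √((Finset.univ.filter fun z => marked z = true).card : ℝ) ^ 2 +
      √((Finset.univ.filter fun z => ¬ marked z = true).card : ℝ) ^ 2 =
      √(Fintype.card D : ℝ) ^ 2 := by
  rw [Real.sq_sqrt (Nat.cast_nonneg _), Real.sq_sqrt (Nat.cast_nonneg _),
    Real.sq_sqrt (Nat.cast_nonneg _)]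
  exact_mod_cast Finset.card_filter_add_card_filter_not (s := Finset.univ)
    (fun z => marked z = true)

variable [Nonempty D]

theorem sqrt_card_pos : 0 < √(Fintype.card D : ℝ) :=
  Real.sqrt_pos.2 (by exact_mod_cast Fintype.card_pos)

theorem sin_groverAngle :
    Real.sin (groverAngle marked) =
      √((Finset.univ.filter fun z => marked z = true).card : ℝ) / √(Fintype.card D) := by
  have hpos := sqrt_card_pos (D := D)
  refine Real.sin_arcsin ?_ ?_
  · have : 0 ≤ √((Finset.univ.filter fun z => marked z = true).card : ℝ) / √(Fintype.card D) := by
      positivity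
    linarith
  · rw [div_le_one hpos]
    exact Real.sqrt_le_sqrt (by exact_mod_cast Finset.card_le_univ _)

theorem cos_groverAngle :
    Real.cos (groverAngle marked) =
      √((Finset.univ.filter fun z => ¬ marked z = true).card : ℝ) / √(Fintype.card D) := by
  have hpos := sqrt_card_pos (D := D)
  rw [groverAngle, Real.cos_arcsin, ← Real.sqrt_sq (show 0 ≤
    √((Finset.univ.filter fun z => ¬ marked z = true).card : ℝ) / √(Fintype.card D) by positivity)]
  congr 1
  have := sq_add_sq_card marked
  field_simp
  linarith

theorem groverAmp_zero (z : D) : groverAmp marked 0 z = 1 / √(Fintype.card D) := by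
  have hpos := sqrt_card_pos (D := D)
  unfold groverAmp
  rw [Nat.cast_zero, mul_zero, zero_add, one_mul, sin_groverAngle, cos_groverAngle]
  split_ifs with hz
  · have : 0 < √((Finset.univ.filter fun z => marked z = true).card : ℝ) :=
      Real.sqrt_pos.2 (Nat.cast_pos.2 (Finset.card_pos.2 ⟨z, by simpa using hz⟩))
    rw [div_right_comm, div_self this.ne']
  · have : 0 < √((Finset.univ.filter fun z => ¬ marked z = true).card : ℝ) :=
      Real.sqrt_pos.2 (Nat.cast_pos.2 (Finset.card_pos.2 ⟨z, by simpa using hz⟩))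
    rw [div_right_comm, div_self this.ne']

theorem groverAmp_succ (T : ℕ) (z : D) :
    (if marked z then groverAmp marked T z else -groverAmp marked T z) -
      2 / (Fintype.card D) * (∑ y, if marked y then groverAmp marked T y else -groverAmp marked T y)
      = groverAmp marked (T + 1) z := by
  have hpos := sqrt_card_pos (D := D)
  have hsq := sq_add_sq_card marked
  have hsin := sin_groverAngle marked
  have hcos := cos_groverAngle marked
  have hR : (Fintype.card D : ℝ) = √(Fintype.card D : ℝ) ^ 2 :=
    (Real.sq_sqrt (Nat.cast_nonneg _)).symm
  have hS : ((Finset.univ.filter fun z => marked z = true).card : ℝ) =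
      √((Finset.univ.filter fun z => marked z = true).card : ℝ) ^ 2 :=
    (Real.sq_sqrt (Nat.cast_nonneg _)).symm
  have hK : ((Finset.univ.filter fun z => ¬ marked z = true).card : ℝ) =
      √((Finset.univ.filter fun z => ¬ marked z = true).card : ℝ) ^ 2 :=
    (Real.sq_sqrt (Nat.cast_nonneg _)).symm
  have hsum : (∑ y, if marked y then groverAmp marked T y else -groverAmp marked T y) =
      √((Finset.univ.filter fun z => marked z = true).card : ℝ) *
        Real.sin ((2 * T + 1) * groverAngle marked) -
      √((Finset.univ.filter fun z => ¬ marked z = true).card : ℝ) *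
        Real.cos ((2 * T + 1) * groverAngle marked) := by
    have : ∀ y, (if marked y then groverAmp marked T y else -groverAmp marked T y) =
        if marked y then Real.sin ((2 * T + 1) * groverAngle marked) /
          √((Finset.univ.filter fun z => marked z = true).card : ℝ) else
          -(Real.cos ((2 * T + 1) * groverAngle marked) /
          √((Finset.univ.filter fun z => ¬ marked z = true).card : ℝ)) := by
      intro y
      unfold groverAmp
      split_ifs <;> rfl
    simp only [this]
    rw [Finset.sum_ite, Finset.sum_const, Finset.sum_const, nsmul_eq_mul, nsmul_eq_mul]
    have key : ∀ c a : ℝ, 0 ≤ c → c * (a / √c) = √c * a := by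
      intro c a hc
      rw [mul_div_left_comm, Real.div_sqrt, mul_comm]
    rw [key _ _ (Nat.cast_nonneg _), mul_neg, key _ _ (Nat.cast_nonneg _), sub_eq_add_neg]
  rw [hsum, hR]
  clear hsum hR
  have hang : ((2 * ((T + 1 : ℕ) : ℝ) + 1) * groverAngle marked) =
      (2 * T + 1) * groverAngle marked + 2 * groverAngle marked := by
    push_cast
    ring
  unfold groverAmp
  rw [hang, Real.sin_add, Real.cos_add, Real.sin_two_mul]
  have hc2 : Real.cos (2 * groverAngle marked) = 1 - 2 * Real.sin (groverAngle marked) ^ 2 := by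
    rw [Real.cos_two_mul, Real.cos_sq']
    ring
  rw [hc2, hsin, hcos]
  generalize Real.sin ((2 * T + 1) * groverAngle marked) = σ
  generalize Real.cos ((2 * T + 1) * groverAngle marked) = κ
  split_ifs with hz
  · have hS0 : 0 < √((Finset.univ.filter fun z => marked z = true).card : ℝ) :=
      Real.sqrt_pos.2 (Nat.cast_pos.2 (Finset.card_pos.2 ⟨z, by simpa using hz⟩))
    clear hS hK
    generalize √((Finset.univ.filter fun z => marked z = true).card : ℝ) = S at *
    generalize √((Finset.univ.filter fun z => ¬ marked z = true).card : ℝ) = K at *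
    generalize √(Fintype.card D : ℝ) = R at *
    field_simp
    ring
  · have hK0 : 0 < √((Finset.univ.filter fun z => ¬ marked z = true).card : ℝ) :=
      Real.sqrt_pos.2 (Nat.cast_pos.2 (Finset.card_pos.2 ⟨z, by simpa using hz⟩))
    clear hS hK
    generalize √((Finset.univ.filter fun z => marked z = true).card : ℝ) = S at *
    generalize √((Finset.univ.filter fun z => ¬ marked z = true).card : ℝ) = K at *
    generalize √(Fintype.card D : ℝ) = R at *
    have hS2 : S ^ 2 = R ^ 2 - K ^ 2 := by linarith
    field_simp
    rw [hS2]
    ring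

omit [Nonempty D] in
/-- The probability of a marked position after `T` iterations. -/
theorem sum_sq_groverAmp (h : ∃ z, marked z = true) (T : ℕ) :
    ∑ z with marked z = true, groverAmp marked T z ^ 2 =
      Real.sin ((2 * T + 1) * groverAngle marked) ^ 2 := by
  obtain ⟨z, hz⟩ := h
  have hc : (0 : ℝ) < ((Finset.univ.filter fun z => marked z = true).card : ℝ) := by
    exact_mod_cast Finset.card_pos.2 ⟨z, by simpa using hz⟩
  rw [Finset.sum_congr rfl (g := fun _ => Real.sin ((2 * T + 1) * groverAngle marked) ^ 2 /
    ((Finset.univ.filter fun z => marked z = true).card : ℝ))]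
  · rw [Finset.sum_const, nsmul_eq_mul]
    field_simp
  · intro y hy
    rw [groverAmp, if_pos (by simpa using hy), div_pow, Real.sq_sqrt hc.le]

theorem two_mul_pow_half_succ (k : ℕ) : 2 * (2 ^ (k + 1) / 2) + 1 ≤ 3 * (2 * (2 ^ k / 2) + 1) := by
  rcases k with - | k
  · simp
  · have h₁ : 2 ^ (k + 1 + 1) / 2 = 2 * 2 ^ k := by
      rw [pow_succ, pow_succ]
      omega
    have h₂ : 2 ^ (k + 1) / 2 = 2 ^ k := by
      rw [pow_succ]
      omega
    omega

/-- One of the iteration numbers `0, 1, 2, 4, …, 2 ^ K` with `2 ^ K ≥ √d` rotates the initial state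
to an angle between `π/4` and `3π/4`: the angles at most triple from one number to the next. -/
theorem exists_sin_sq_ge (h : ∃ z, marked z = true) {K : ℕ} (hK : Fintype.card D ≤ 4 ^ K) :
    ∃ k < K + 2,
      1 / 2 ≤ Real.sin ((2 * ((2 ^ k / 2 : ℕ) : ℝ) + 1) * groverAngle marked) ^ 2 := by
  classical
  have hpos := sqrt_card_pos (D := D)
  have hpi := Real.pi_gt_three
  have hpi4 := Real.pi_le_four
  set θ := groverAngle marked with hθ
  have hθ0 : 0 ≤ θ := Real.arcsin_nonneg.2 (by positivity)
  have hθ2 : θ ≤ Real.pi / 2 := Real.arcsin_le_pi_div_two _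
  have hsin : 1 / √(Fintype.card D : ℝ) ≤ θ := by
    refine le_trans ?_ (Real.sin_le hθ0)
    rw [sin_groverAngle]
    obtain ⟨z, hz⟩ := h
    gcongr
    rw [Real.one_le_sqrt]
    exact_mod_cast Finset.card_pos.2 ⟨z, by simpa using hz⟩
  have hsqrt : √(Fintype.card D : ℝ) ≤ 2 ^ K := by
    rw [Real.sqrt_le_left (by positivity), ← pow_mul, mul_comm, pow_mul]
    norm_num
    exact_mod_cast hK
  have hex : ∃ k, Real.pi / 4 ≤ (2 * ((2 ^ k / 2 : ℕ) : ℝ) + 1) * θ := by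
    refine ⟨K + 1, ?_⟩
    rw [pow_succ, Nat.mul_div_cancel _ two_pos]
    push_cast
    have h1 : 1 ≤ 2 ^ K * θ := by
      rw [div_le_iff₀ hpos] at hsin
      nlinarith
    nlinarith
  have hle : Nat.find hex ≤ K + 1 := Nat.find_min' hex (by
    rw [pow_succ, Nat.mul_div_cancel _ two_pos]
    push_cast
    have h1 : 1 ≤ 2 ^ K * θ := by
      rw [div_le_iff₀ hpos] at hsin
      nlinarith
    nlinarith)
  refine ⟨Nat.find hex, by omega, ?_⟩
  have hlow := Nat.find_spec hex
  have hup : (2 * ((2 ^ Nat.find hex / 2 : ℕ) : ℝ) + 1) * θ ≤ 3 * Real.pi / 4 := by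
    rcases hk : Nat.find hex with - | k
    · norm_num
      linarith
    · have hmin := Nat.find_min hex (m := k) (by omega)
      rw [not_le] at hmin
      have h3 : (2 * ((2 ^ (k + 1) / 2 : ℕ) : ℝ) + 1) ≤ 3 * (2 * ((2 ^ k / 2 : ℕ) : ℝ) + 1) := by
        exact_mod_cast two_mul_pow_half_succ k
      nlinarith
  have hcos := Real.cos_nonpos_of_pi_div_two_le_of_le
    (x := 2 * ((2 * ((2 ^ Nat.find hex / 2 : ℕ) : ℝ) + 1) * θ)) (by linarith) (by linarith)
  rw [Real.sin_sq_eq_half_sub]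
  linarith

end Amplitudes

/-! ### Grover search in the query model -/

section Grover

variable {I Z D : Type} [Fintype I] [DecidableEq I] [Fintype Z] [DecidableEq Z] [AddCommGroup Z]
  [Fintype D] [DecidableEq D]

/-- The permutation that puts index and answer into the work registers, and prepares the index
register for a second query at `nxt a`, where `a` is the first answer: work registers in the state
`(j₀, 0)` become `(nxt a, 0)` in the index and answer registers. -/
def followEquiv (j₀ : I) (nxt : Z → I) : Equiv.Perm (I × Z × (I × Z)) where
  toFun b := (Equiv.swap j₀ (nxt b.2.1) b.2.2.1, b.2.2.2, (b.1, b.2.1))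
  invFun b := (b.2.2.1, b.2.2.2, (Equiv.swap j₀ (nxt b.2.2.2) b.1, b.2.1))
  left_inv b := by simp
  right_inv b := by simp

/-- Negation of the answer register. A query between two negations undoes a query. -/
def negAnswerEquiv : Equiv.Perm (I × Z × (I × Z)) where
  toFun b := (b.1, -b.2.1, b.2.2)
  invFun b := (b.1, -b.2.1, b.2.2)
  left_inv b := by simp
  right_inv b := by simp

/-- The basis state that stands for the position `z` between two Grover iterations. -/
def homeState (e : D → I) (j₀ : I) (z : D) : I × Z × (I × Z) := (e z, 0, (j₀, 0))

omit [Fintype I] [DecidableEq I] [Fintype Z] [DecidableEq Z] [Fintype D] [DecidableEq D] in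
theorem homeState_injective {e : D → I} (he : Function.Injective e) (j₀ : I) :
    Function.Injective (homeState (Z := Z) e j₀) :=
  fun _ _ h => he (congrArg Prod.fst h)

/-- The unitaries of Grover's algorithm on the positions `D`, the position `z` being the query index
`e z`. A position is marked if `test` accepts the answer `a` of `e z` and the answer of the index
`nxt a`. One iteration uses four queries: two compute the answers, two erase them. The sign is
`-1` on the unmarked positions, so that one reflection in the uniform superposition completes the
iteration. -/
def groverU (e : D → I) (j₀ : I) (nxt : Z → I) (test : Z → Z → Bool) (z₀ : D) (t : ℕ) :
    Matrix.unitaryGroup (I × Z × (I × Z)) ℂ :=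
  if t = 0 then
    householder (superpose (homeState e j₀) fun z =>
      (if z = z₀ then 1 else 0) - 1 / √(Fintype.card D))
  else if t % 4 = 1 then signedPerm (followEquiv j₀ nxt) fun _ => true
  else if t % 4 = 2 then signedPerm negAnswerEquiv fun b => test b.2.2.2 b.2.1
  else if t % 4 = 3 then
    signedPerm ((followEquiv j₀ nxt).symm.trans negAnswerEquiv) fun _ => true
  else householder (superpose (homeState e j₀) fun _ => 1)

/-- Grover's algorithm with `T` iterations, starting from the basis state of `z₀`. -/
def groverAlg (e : D → I) (j₀ : I) (nxt : Z → I) (test : Z → Z → Bool) (z₀ : D) (T : ℕ) :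
    QueryAlg I Z D where
  W := I × Z
  fintypeW := inferInstance
  decEqW := inferInstance
  queries := 4 * T
  init := homeState e j₀ z₀
  U := groverU e j₀ nxt test z₀
  out b :=
    haveI : Nonempty D := ⟨z₀⟩
    Function.invFun e b.1

/-- The recursion of `QueryAlg.state` for a fixed work register `W`, so that the type of the states
does not depend on an algorithm. -/
def evolve {W : Type} [Fintype W] [DecidableEq W] (x : I → Z) (init : I × Z × W)
    (U : ℕ → Matrix.unitaryGroup (I × Z × W) ℂ) : ℕ → (I × Z × W → ℂ)
  | 0 => (U 0).1.mulVec (Pi.single init 1)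
  | t + 1 => (U (t + 1)).1.mulVec (QueryAlg.queryOp x (evolve x init U t))

/-- Whether the position `z` is marked on the input `x`. -/
def isMarked (e : D → I) (nxt : Z → I) (test : Z → Z → Bool) (x : I → Z) (z : D) : Bool :=
  test (x (e z)) (x (nxt (x (e z))))

variable {e : D → I} (he : Function.Injective e) (j₀ : I) (nxt : Z → I) (test : Z → Z → Bool)
  (z₀ : D) (x : I → Z)

theorem groverAlg_state_eq_evolve (T t : ℕ) :
    (groverAlg e j₀ nxt test z₀ T).state x t =
      evolve x (homeState e j₀ z₀) (groverU e j₀ nxt test z₀) t := by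
  induction t with
  | zero => rfl
  | succ t ih =>
    change (groverU e j₀ nxt test z₀ (t + 1)).1.mulVec (QueryAlg.queryOp x _) = _
    rw [ih]
    rfl

include he in
theorem evolve_grover_zero :
    evolve x (homeState e j₀ z₀) (groverU e j₀ nxt test z₀) 0 =
      superpose (homeState e j₀) fun _ => 1 / √(Fintype.card D) := by
  have : Nonempty D := ⟨z₀⟩
  have hpos := sqrt_card_pos (D := D)
  have hR : (Fintype.card D : ℝ) = √(Fintype.card D : ℝ) ^ 2 :=
    (Real.sq_sqrt (Nat.cast_nonneg _)).symm
  have hinit : (Pi.single (homeState e j₀ z₀) 1 : I × Z × (I × Z) → ℂ) =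
      superpose (homeState e j₀) fun z => if z = z₀ then 1 else 0 := by
    rw [superpose, Finset.sum_eq_single z₀] <;> simp +contextual
  rw [evolve, groverU, if_pos rfl, hinit, householder_mulVec_superpose (homeState_injective he j₀)]
  congr 1
  ext z
  set r := 1 / √(Fintype.card D : ℝ) with hr
  have h1 : ∑ y : D, ((if y = z₀ then 1 else 0) - r) * (if y = z₀ then 1 else 0) = 1 - r := by
    simp
  have h2 : ∑ y : D, ((if y = z₀ then 1 else 0) - r) * ((if y = z₀ then 1 else 0) - r) =
      2 * (1 - r) := by
    have : ∀ y : D, ((if y = z₀ then (1 : ℝ) else 0) - r) * ((if y = z₀ then 1 else 0) - r) =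
        (if y = z₀ then 1 - 2 * r else 0) + r ^ 2 := by
      intro y
      split_ifs <;> ring
    simp only [this, Finset.sum_add_distrib, Finset.sum_ite_eq', Finset.mem_univ, if_true,
      Finset.sum_const, Finset.card_univ, nsmul_eq_mul]
    have : (Fintype.card D : ℝ) * r ^ 2 = 1 := by
      rw [hr, div_pow, ← hR]
      have : (Fintype.card D : ℝ) ≠ 0 := by
        rw [hR]
        positivity
      field_simp
    rw [this]
    ring
  rw [h1, h2]
  rcases eq_or_ne r 1 with h | h
  · -- a single position: the reflection is the identity
    have hc : Fintype.card D = 1 := by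
      have : √(Fintype.card D : ℝ) = 1 := by
        rw [hr, div_eq_one_iff_eq hpos.ne'] at h
        exact h.symm
      rw [this] at hR
      exact_mod_cast hR.trans (one_pow 2)
    have := Fintype.card_le_one_iff.1 hc.le z z₀
    simp [h, this]
  · have : 1 - r ≠ 0 := sub_ne_zero.2 h.symm
    rw [show 2 / (2 * (1 - r)) * (1 - r) = 1 by field_simp]
    ring

include he in
theorem evolve_grover [Nonempty D] (T : ℕ) :
    evolve x (homeState e j₀ z₀) (groverU e j₀ nxt test z₀) (4 * T) =
      superpose (homeState e j₀) (groverAmp (isMarked e nxt test x) T) := by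
  induction T with
  | zero =>
    rw [mul_zero, evolve_grover_zero he]
    congr 1
    ext z
    rw [groverAmp_zero]
  | succ T ih =>
    have hU1 : groverU e j₀ nxt test z₀ (4 * T + 1) =
        signedPerm (followEquiv j₀ nxt) fun _ => true := by
      rw [groverU, if_neg (by omega), if_pos (by omega)]
    have hU2 : groverU e j₀ nxt test z₀ (4 * T + 1 + 1) =
        signedPerm negAnswerEquiv fun b => test b.2.2.2 b.2.1 := by
      rw [groverU, if_neg (by omega), if_neg (by omega), if_pos (by omega)]
    have hU3 : groverU e j₀ nxt test z₀ (4 * T + 1 + 1 + 1) =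
        signedPerm ((followEquiv j₀ nxt).symm.trans negAnswerEquiv) fun _ => true := by
      rw [groverU, if_neg (by omega), if_neg (by omega), if_neg (by omega), if_pos (by omega)]
    have hU4 : groverU e j₀ nxt test z₀ (4 * T + 1 + 1 + 1 + 1) =
        householder (superpose (homeState e j₀) fun _ => 1) := by
      rw [groverU, if_neg (by omega), if_neg (by omega), if_neg (by omega), if_neg (by omega)]
    rw [show 4 * (T + 1) = 4 * T + 1 + 1 + 1 + 1 by ring, evolve, evolve, evolve, evolve, ih, hU1,
      hU2, hU3, hU4, queryOp_superpose, signedPerm_mulVec_superpose, queryOp_superpose,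
      signedPerm_mulVec_superpose, queryOp_superpose, signedPerm_mulVec_superpose,
      queryOp_superpose]
    have hhome : ∀ z, ((e z, (0 : Z), (j₀, (0 : Z))) : I × Z × (I × Z)) = homeState e j₀ z :=
      fun _ => rfl
    simp only [homeState, followEquiv, negAnswerEquiv, Equiv.coe_fn_mk, Equiv.trans_apply,
      Equiv.coe_fn_symm_mk, zero_add, Equiv.swap_apply_left, Equiv.swap_apply_right, neg_add_cancel,
      if_true]
    simp only [hhome]
    rw [householder_mulVec_superpose (homeState_injective he j₀)]
    congr 1
    ext z
    rw [← groverAmp_succ]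
    simp only [mul_one, one_mul, Finset.sum_const, Finset.card_univ, nsmul_eq_mul]
    rfl

include he in
/-- The probability that Grover's algorithm returns an unmarked position. -/
theorem groverAlg_output_unmarked [Nonempty D] (h : ∃ z, isMarked e nxt test x z = true) (T : ℕ) :
    ((groverAlg e j₀ nxt test z₀ T).output x).toOuterMeasure
        {z | isMarked e nxt test x z = false} ≤
      ENNReal.ofReal
        (1 - Real.sin ((2 * T + 1) * groverAngle (isMarked e nxt test x)) ^ 2) := by
  classical
  set A := groverAlg e j₀ nxt test z₀ T with hA
  set M := isMarked e nxt test x with hM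
  have hhome := homeState_injective (Z := Z) he j₀
  rw [QueryAlg.output, PMF.toOuterMeasure_map_apply, PMF.toOuterMeasure_ofFintype_apply]
  have hout : ∀ z, A.out (homeState e j₀ z) = z := fun z =>
    Function.leftInverse_invFun he z
  have hstate : ∀ z, A.state x A.queries (homeState e j₀ z) = (groverAmp M T z : ℂ) := by
    intro z
    rw [groverAlg_state_eq_evolve]
    change evolve x (homeState e j₀ z₀) (groverU e j₀ nxt test z₀) (4 * T) _ = _
    rw [evolve_grover he, superpose_apply hhome]
  have hind : ∀ b, (A.out ⁻¹' {z | M z = false}).indicator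
      (fun b => ENNReal.ofReal (‖A.state x A.queries b‖ ^ 2)) b =
      ENNReal.ofReal (if M (A.out b) = false then ‖A.state x A.queries b‖ ^ 2 else 0) := by
    intro b
    by_cases hb : M (A.out b) = false
    · rw [Set.indicator_of_mem (by simpa using hb), if_pos hb]
    · rw [Set.indicator_of_notMem (by simpa using hb), if_neg hb, ENNReal.ofReal_zero]
  simp only [hind]
  rw [tsum_fintype, ← ENNReal.ofReal_sum_of_nonneg (fun b _ => by split_ifs <;> positivity)]
  refine ENNReal.ofReal_le_ofReal ?_
  have htot := A.sum_normSq_state x A.queries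
  rw [← sum_sq_groverAmp M h, ← htot, ← Finset.sum_filter,
    ← Finset.sum_filter_add_sum_filter_not Finset.univ (fun b => M (A.out b) = false)]
  have : ∑ z with M z = true, groverAmp M T z ^ 2 ≤
      ∑ b with ¬ M (A.out b) = false, ‖A.state x A.queries b‖ ^ 2 := by
    calc ∑ z with M z = true, groverAmp M T z ^ 2
        = ∑ z with M z = true, ‖A.state x A.queries (homeState e j₀ z)‖ ^ 2 := by
          refine Finset.sum_congr rfl fun z _ => ?_
          rw [hstate, Complex.norm_real, Real.norm_eq_abs, sq_abs]
      _ = ∑ b ∈ (Finset.univ.filter fun z => M z = true).image (homeState e j₀),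
            ‖A.state x A.queries b‖ ^ 2 := by
          rw [Finset.sum_image fun _ _ _ _ h => hhome h]
      _ ≤ _ := by
          refine Finset.sum_le_sum_of_subset_of_nonneg ?_ fun _ _ _ => by positivity
          intro b hb
          obtain ⟨z, hz, rfl⟩ := Finset.mem_image.1 hb
          exact Finset.mem_filter.2 ⟨Finset.mem_univ _, by rw [hout]; simpa using hz⟩
  linarith

end Grover

/-! ### Detecting a marked position -/

namespace QProg

variable {I Z : Type} [Fintype I] [DecidableEq I] [Fintype Z] [DecidableEq Z] [AddCommGroup Z]

/-- Run the programs of a list until one of them returns `true`. -/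
def anyTrue : List (QProg I Z Bool) → QProg I Z Bool
  | [] => pure false
  | P :: L => do
    let b ← P
    if b then pure true else anyTrue L

theorem always_anyTrue_queries {ι : Type} {x : I → Z} (L : List ι) (P : ι → QProg I Z Bool)
    (c : ι → ℝ) (hc : ∀ i, 0 ≤ c i) (h : ∀ i, (P i).Always x fun _ q => (q : ℝ) ≤ c i) :
    (anyTrue (L.map P)).Always x fun _ q => (q : ℝ) ≤ (L.map c).sum := by
  induction L with
  | nil => simp [anyTrue, always_pure]
  | cons i L ih =>
    rw [List.map_cons, anyTrue, always_bind]
    refine (h i).mono fun b q hq => ?_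
    have hL : 0 ≤ (L.map c).sum := List.sum_nonneg (by simp [hc])
    rw [List.map_cons, List.sum_cons]
    cases b
    · refine ih.mono fun _ q' hq' => ?_
      push_cast
      linarith
    · rw [if_pos rfl, always_pure]
      push_cast
      linarith

theorem errorProb_anyTrue_false {x : I → Z} (L : List (QProg I Z Bool))
    (h : ∀ P ∈ L, P.errorProb x false = 0) : (anyTrue L).errorProb x false = 0 := by
  induction L with
  | nil => exact errorProb_pure _ _
  | cons P L ih =>
    have h₂ : (anyTrue L).errorProb x false ≤ 0 := (ih fun P' hP' => h P' (by simp [hP'])).le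
    rw [anyTrue]
    refine le_antisymm ((errorProb_bind_le (h P (by simp)).le ?_).trans_eq (add_zero 0)) zero_le
    exact h₂

theorem errorProb_anyTrue_cons (x : I → Z) (P : QProg I Z Bool) (L : List (QProg I Z Bool)) :
    (anyTrue (P :: L)).errorProb x true = P.errorProb x true * (anyTrue L).errorProb x true := by
  rw [anyTrue, errorProb_bind, tsum_bool]
  have : P.errorProb x true = P.dist x false := by
    rw [errorProb_eq, show {b : Bool | b ≠ true} = {false} by ext b; cases b <;> simp,
      PMF.toOuterMeasure_apply_singleton]
  simp [this, errorProb_pure]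

theorem errorProb_anyTrue_le_of_mem {x : I → Z} {L : List (QProg I Z Bool)} {P : QProg I Z Bool}
    (hP : P ∈ L) : (anyTrue L).errorProb x true ≤ P.errorProb x true := by
  induction L with
  | nil => simp at hP
  | cons P' L ih =>
    rw [errorProb_anyTrue_cons]
    rcases List.mem_cons.1 hP with rfl | h
    · exact mul_le_of_le_one_right' (errorProb_le_one _ _ _)
    · exact (mul_le_of_le_one_left' (errorProb_le_one _ _ _)).trans (ih h)

theorem errorProb_anyTrue_replicate (x : I → Z) (P : QProg I Z Bool) (r : ℕ) :
    (anyTrue (List.replicate r P)).errorProb x true ≤ P.errorProb x true ^ r := by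
  induction r with
  | zero => simpa using errorProb_le_one _ _ _
  | succ r ih =>
    rw [List.replicate_succ, errorProb_anyTrue_cons, pow_succ']
    gcongr

end QProg

section Detect

variable {I Z D : Type} [Fintype I] [DecidableEq I] [Fintype Z] [DecidableEq Z] [AddCommGroup Z]
  [Fintype D] [DecidableEq D]

open QProg

/-- Run Grover's algorithm with `T` iterations and check its outcome with two classical queries. -/
def groverTry (e : D → I) (nxt : Z → I) (test : Z → Z → Bool) (z₀ : D) (T : ℕ) :
    QProg I Z Bool :=
  call (groverAlg e (e z₀) nxt test z₀ T) fun z => do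
    let a ← read (e z)
    let a' ← read (nxt a)
    pure (test a a')

/-- Search for a marked position, with the iteration numbers `0, 1, 2, 4, …` up to about `√|D|`. -/
def detectOnce (e : D → I) (nxt : Z → I) (test : Z → Z → Bool) (z₀ : D) : QProg I Z Bool :=
  anyTrue ((List.range (Nat.clog 4 (Fintype.card D) + 2)).map fun k =>
    groverTry e nxt test z₀ (2 ^ k / 2))

/-- Search for a marked position `r` times. -/
def detect (e : D → I) (nxt : Z → I) (test : Z → Z → Bool) (r : ℕ) : QProg I Z Bool :=
  open scoped Classical in
  if h : Nonempty D then anyTrue (List.replicate r (detectOnce e nxt test h.some)) else pure false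

variable {e : D → I} (nxt : Z → I) (test : Z → Z → Bool) (x : I → Z)

theorem always_groverTry (z₀ : D) (T : ℕ) :
    (groverTry e nxt test z₀ T).Always x fun _ q => q = 4 * T + 2 :=
  always_call fun z => by
    simp only [always_bind, always_read, always_pure]
    rfl

theorem errorProb_groverTry_false (h : ∀ z, isMarked e nxt test x z = false) (z₀ : D) (T : ℕ) :
    (groverTry e nxt test z₀ T).errorProb x false = 0 := by
  rw [errorProb_eq_zero_iff]
  refine always_call fun z => ?_
  simp only [always_bind, always_read, always_pure]
  exact h z

theorem errorProb_groverTry_true (he : Function.Injective e)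
    (h : ∃ z, isMarked e nxt test x z = true) (z₀ : D) (T : ℕ) :
    (groverTry e nxt test z₀ T).errorProb x true ≤
      ENNReal.ofReal
        (1 - Real.sin ((2 * T + 1) * groverAngle (isMarked e nxt test x)) ^ 2) := by
  have : Nonempty D := ⟨z₀⟩
  refine le_trans (le_of_eq ?_) (groverAlg_output_unmarked he (e z₀) nxt test z₀ x h T)
  rw [groverTry, errorProb_eq, dist_call, PMF.toOuterMeasure_bind_apply, PMF.toOuterMeasure_apply]
  refine tsum_congr fun z => ?_
  have hdist : (do
      let a ← read (e z)
      let a' ← read (nxt a)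
      pure (test a a') : QProg I Z Bool).dist x = PMF.pure (isMarked e nxt test x z) := by
    simp only [QProg.dist, run_bind, run_read, PMF.pure_bind, pure_eq_done, run, PMF.pure_map]
    rfl
  rw [hdist, PMF.toOuterMeasure_pure_apply]
  cases hz : isMarked e nxt test x z <;> simp [hz]

theorem errorProb_detectOnce_false (h : ∀ z, isMarked e nxt test x z = false) (z₀ : D) :
    (detectOnce e nxt test z₀).errorProb x false = 0 := by
  refine errorProb_anyTrue_false _ fun P hP => ?_
  obtain ⟨k, _, rfl⟩ := List.mem_map.1 hP
  exact errorProb_groverTry_false nxt test x h _ _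

theorem errorProb_detectOnce_true (he : Function.Injective e)
    (h : ∃ z, isMarked e nxt test x z = true) (z₀ : D) :
    (detectOnce e nxt test z₀).errorProb x true ≤ 2⁻¹ := by
  have : Nonempty D := ⟨z₀⟩
  obtain ⟨k, hk, hsin⟩ := exists_sin_sq_ge (isMarked e nxt test x) h
    (Nat.le_pow_clog (by norm_num : 1 < 4) (Fintype.card D))
  refine (errorProb_anyTrue_le_of_mem (List.mem_map.2 ⟨k, List.mem_range.2 hk, rfl⟩)).trans
    ((errorProb_groverTry_true nxt test x he h _ _).trans ?_)
  rw [show (2⁻¹ : ℝ≥0∞) = ENNReal.ofReal (1 / 2) by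
    rw [one_div, ENNReal.ofReal_inv_of_pos two_pos, ENNReal.ofReal_ofNat]]
  exact ENNReal.ofReal_le_ofReal (by linarith)

theorem always_detectOnce (z₀ : D) :
    (detectOnce e nxt test z₀).Always x fun _ q => (q : ℝ) ≤ 32 * √(Fintype.card D) := by
  have : Nonempty D := ⟨z₀⟩
  set K := Nat.clog 4 (Fintype.card D) with hK
  have hcard : (1 : ℝ) ≤ √(Fintype.card D) := by
    rw [Real.one_le_sqrt]
    exact_mod_cast Fintype.card_pos (α := D)
  have h2K : (2 : ℝ) ^ K ≤ 2 * √(Fintype.card D) := by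
    rcases hK' : K with - | k
    · simp only [pow_zero]
      linarith
    · have hlt : 4 ^ k < Fintype.card D := (Nat.lt_clog_iff_pow_lt (by norm_num)).1 (by omega)
      have : (2 : ℝ) ^ k ≤ √(Fintype.card D) := by
        rw [Real.le_sqrt (by positivity) (by positivity), ← pow_mul, mul_comm, pow_mul]
        norm_num
        exact_mod_cast hlt.le
      rw [pow_succ]
      linarith
  refine (always_anyTrue_queries _ _ (fun k => 4 * 2 ^ k) (fun _ => by positivity)
    fun k => ?_).mono fun _ q hq => hq.trans ?_
  · refine (always_groverTry nxt test x _ _).mono fun _ q hq => ?_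
    have h₁ : 4 * (2 ^ k / 2) + 2 ≤ 4 * 2 ^ k := by
      have := Nat.one_le_two_pow (n := k)
      omega
    rw [hq]
    exact_mod_cast h₁
  · have hsum : ∀ m : ℕ, ((List.range m).map fun k => (4 : ℝ) * 2 ^ k).sum = 4 * (2 ^ m - 1) := by
      intro m
      induction m with
      | zero => simp
      | succ m ih =>
        rw [List.range_succ, List.map_append, List.sum_append, ih]
        simp only [List.map_cons, List.map_nil, List.sum_cons, List.sum_nil]
        ring
    rw [hsum, pow_add]
    linarith

theorem errorProb_detect_false (h : ∀ z, isMarked e nxt test x z = false) (r : ℕ) :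
    (detect e nxt test r).errorProb x false = 0 := by
  rw [detect]
  split_ifs
  · refine errorProb_anyTrue_false _ fun P hP => ?_
    rw [List.eq_of_mem_replicate hP]
    exact errorProb_detectOnce_false nxt test x h _
  · exact errorProb_pure _ _

theorem errorProb_detect_true (he : Function.Injective e)
    (h : ∃ z, isMarked e nxt test x z = true) (r : ℕ) :
    (detect e nxt test r).errorProb x true ≤ 2⁻¹ ^ r := by
  rw [detect, dif_pos ⟨h.choose⟩]
  refine (errorProb_anyTrue_replicate _ _ _).trans ?_
  gcongr
  exact errorProb_detectOnce_true nxt test x he h _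

theorem always_detect (r : ℕ) :
    (detect e nxt test r).Always x fun _ q => (q : ℝ) ≤ r * (32 * √(Fintype.card D)) := by
  rw [detect]
  split_ifs
  · have := always_anyTrue_queries (List.replicate r ()) (fun _ => detectOnce e nxt test _)
      (fun _ => 32 * √(Fintype.card D)) (fun _ => by positivity)
      fun _ => always_detectOnce nxt test x (Classical.choice ‹_›)
    simpa only [List.map_replicate, List.sum_replicate, nsmul_eq_mul] using this
  · rw [always_pure, Nat.cast_zero]
    positivity

end Detect

/-! ### The gate subroutine -/

theorem Gate.eval_eq_ite (g : Gate) (l : List Bool) [Decidable (∃ b ∈ l, (b != g.neutral) = true)] :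
    g.eval l = if ∃ b ∈ l, (b != g.neutral) = true then !g.neutral else g.neutral := by
  split_ifs with h
  · obtain ⟨b, hb, hne⟩ := h
    cases g <;> cases b <;> simp_all [Gate.eval, Gate.neutral]
  · push Not at h
    cases g <;> simp_all [Gate.eval, Gate.neutral]

theorem bit_eq_one (b : Bool) : (bit b == 1) = b := by
  cases b <;> rfl

namespace Frame

variable {n : ℕ} (F : Frame n)

/-- Some query index, used where the answer does not matter. -/
def someIndex (v : Fin n) : F.Index :=
  if h : F.deg v = 0 then Sum.inr ⟨v, h⟩ else Sum.inl ⟨v, ⟨0, Nat.pos_of_ne_zero h⟩⟩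

/-- The index of the variable at the vertex that an answer points to, if that is a sink. -/
def sinkIndex (v : Fin n) (a : Answer n) : F.Index :=
  if h : F.deg a.1 = 0 then Sum.inr ⟨a.1, h⟩ else F.someIndex v

/-- Search for a decisive argument of the gate at `v`. -/
def gateProg [NeZero n] (t : Fin n → Bool) (v : Fin n) : F.Prog Bool :=
  if h : F.deg v = 0 then pure false
  else do
    let b ← detect (fun z : Fin (F.deg v) => (Sum.inl ⟨v, z⟩ : F.Index)) (F.sinkIndex v)
      (fun a a' => ((if F.deg a.1 = 0 then a'.2 == 1 else t a.1) == (a.2 == 1))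
        != (F.gate ⟨v, h⟩).neutral) 1
    pure (if b then !(F.gate ⟨v, h⟩).neutral else (F.gate ⟨v, h⟩).neutral)

end Frame

namespace AndOrNotDag

variable {n N : ℕ} (G : AndOrNotDag n N)

theorem inl_injective (v : Fin n) :
    Function.Injective fun z : Fin (G.deg v) => (Sum.inl ⟨v, z⟩ : G.Index) := by
  intro y z h
  simpa using h

variable [NeZero n] (x : Fin N → Bool)

theorem isMarked_gate (t : Fin n → Bool) (v : Fin n) (b : Bool) (z : Fin (G.deg v)) :
    isMarked (fun z : Fin (G.deg v) => (Sum.inl ⟨v, z⟩ : G.Index)) (G.sinkIndex v)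
      (fun a a' => ((if G.deg a.1 = 0 then a'.2 == 1 else t a.1) == (a.2 == 1)) != b)
      (G.oracle x) z = (G.arg x t v z != b) := by
  simp only [isMarked, oracle, bit_eq_one, arg]
  congr 2
  by_cases h : G.deg (G.adj v z) = 0
  · simp [h, Frame.sinkIndex, bit_eq_one]
  · simp [h]

theorem always_gateProg (t : Fin n → Bool) (v : Fin n) :
    (G.gateProg t v).Always (G.oracle x) fun _ q => (q : ℝ) ≤ 32 * √(G.deg v) := by
  rw [Frame.gateProg]
  split_ifs with h
  · rw [QProg.always_pure, Nat.cast_zero]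
    positivity
  · rw [QProg.always_bind]
    refine (always_detect _ _ _ 1).mono fun b q hq => ?_
    rw [QProg.always_pure]
    simpa using hq

theorem errorProb_gateProg (t : Fin n → Bool) (v : Fin n) (hv : G.deg v ≠ 0) :
    (G.gateProg t v).errorProb (G.oracle x) ((G.gate ⟨v, hv⟩).eval (List.ofFn (G.arg x t v))) ≤
      if (G.gate ⟨v, hv⟩).eval (List.ofFn (G.arg x t v)) = (G.gate ⟨v, hv⟩).neutral then 0
      else 1 / 2 := by
  classical
  rw [Frame.gateProg, dif_neg hv, Gate.eval_eq_ite]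
  by_cases h : ∃ b ∈ List.ofFn (G.arg x t v), (b != (G.gate ⟨v, hv⟩).neutral) = true
  · rw [if_pos h, if_neg (by simp)]
    obtain ⟨b, hb, hne⟩ := h
    obtain ⟨z, rfl⟩ := (List.mem_ofFn' _ _).1 hb
    have := errorProb_detect_true (G.sinkIndex v)
      (fun a a' => ((if G.deg a.1 = 0 then a'.2 == 1 else t a.1) == (a.2 == 1))
        != (G.gate ⟨v, hv⟩).neutral) (G.oracle x) (G.inl_injective v)
        ⟨z, by rw [isMarked_gate]; exact hne⟩ 1
    refine (QProg.errorProb_bind_le this (δ := 0) ?_).trans ?_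
    · rw [if_pos rfl, QProg.errorProb_pure]
    · simp
  · rw [if_neg h, if_pos rfl]
    push Not at h
    have := errorProb_detect_false (G.sinkIndex v)
      (fun a a' => ((if G.deg a.1 = 0 then a'.2 == 1 else t a.1) == (a.2 == 1))
        != (G.gate ⟨v, hv⟩).neutral) (G.oracle x) (e := fun z : Fin (G.deg v) =>
          (Sum.inl ⟨v, z⟩ : G.Index))
        (fun z => by
          rw [isMarked_gate]
          simpa using h (G.arg x t v z) ((List.mem_ofFn' _ _).2 ⟨z, rfl⟩)) 1
    refine (QProg.errorProb_bind_le this.le (δ := 0) ?_).trans (add_zero 0).le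
    rw [if_neg (by simp), QProg.errorProb_pure]

end AndOrNotDag

/-! ### The search for the first fresh position -/

namespace Frame

variable {n : ℕ} (F : Frame n) [NeZero n] (visited : Fin n → Bool) (v : Fin n)

/-- Search the positions `a, …, a + m - 1` of the adjacency list of `v` for a fresh one, `r`
times. -/
def detectFresh (a m r : ℕ) : F.Prog Bool :=
  detect (fun z : {z : Fin (F.deg v) // a ≤ (z : ℕ) ∧ (z : ℕ) < a + m} =>
    (Sum.inl ⟨v, z.1⟩ : F.Index)) (fun _ => F.someIndex v)
    (fun b _ => !visited b.1 && decide (F.deg b.1 ≠ 0)) r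

/-- Binary search for the first fresh position among `a, …, a + 2 ^ k - 1`. The number `r` of
repetitions grows as the interval shrinks: the error probabilities form a geometric series, whatever
the length of the list, and so do the costs. -/
def descend : ℕ → ℕ → ℕ → F.Prog (Option (Fin (F.deg v)))
  | 0, a, r => do
    let b ← F.detectFresh visited v a 1 r
    pure (if b then (if h : a < F.deg v then some ⟨a, h⟩ else none) else none)
  | k + 1, a, r => do
    let b ← F.detectFresh visited v a (2 ^ k) r
    if b then descend k a (r + 1) else descend k (a + 2 ^ k) (r + 1)

/-- Search the blocks of lengths `2 ^ k, 2 ^ (k + 1), …`, the first of which begins at the position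
`start + 2 ^ k - 1`. The blocks are disjoint, so that a position found in a block of length `2 ^ k`
is at distance at least `2 ^ k - 1` from `start`, also after an error. -/
def blockSearch (start r : ℕ) : ℕ → ℕ → F.Prog (Option (Fin (F.deg v)))
  | 0, _ => pure none
  | fuel + 1, k =>
    if F.deg v ≤ start + 2 ^ k - 1 then pure none
    else do
      let b ← F.detectFresh visited v (start + 2 ^ k - 1) (2 ^ k) r
      if b then F.descend visited v k (start + 2 ^ k - 1) r else blockSearch start r fuel (k + 1)

/-- The search for the first fresh position at or after `start`. With `r = 2 ⌈log₂ nhat⌉ + 2`, the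
error probability `3 * 2⁻¹ ^ r` of the block search is at most `1 / nhat²`. -/
def firstOneProg (start : ℕ) : F.Prog (Option (Fin (F.deg v))) :=
  F.blockSearch visited v start (2 * Nat.clog 2 F.nhat + 2) (F.deg v + 1) 0

end Frame

namespace AndOrNotDag

variable {n N : ℕ} (G : AndOrNotDag n N)

theorem firstFresh_eq_none_iff {visited : Fin n → Bool} {v : Fin n} {start : ℕ} :
    G.firstFresh visited v start = none ↔
      ∀ z : Fin (G.deg v), start ≤ (z : ℕ) → ¬ G.Fresh visited v z := by
  simp [firstFresh, List.find?_eq_none]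

theorem firstFresh_eq_some_iff {visited : Fin n → Bool} {v : Fin n} {start : ℕ}
    {z : Fin (G.deg v)} :
    G.firstFresh visited v start = some z ↔ (start ≤ (z : ℕ) ∧ G.Fresh visited v z) ∧
      ∀ y : Fin (G.deg v), start ≤ (y : ℕ) → y < z → ¬ G.Fresh visited v y := by
  rw [firstFresh, List.find?_eq_some_iff_getElem]
  simp only [decide_eq_true_eq]
  refine and_congr_right fun _ => ?_
  constructor
  · rintro ⟨i, hi, hz, hmin⟩ y hy hyz hf
    have hiz : i = (z : ℕ) := by simp [← hz]
    have := hmin y (by rw [hiz]; exact hyz)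
    simp at this
    exact this hy hf
  · intro h
    refine ⟨z, by simp, by simp, fun j hj => ?_⟩
    have := fun h' => h ⟨j, hj.trans z.2⟩ h' hj
    simpa using this

variable [NeZero n] (x : Fin N → Bool) (visited : Fin n → Bool) (v : Fin n)

theorem isMarked_fresh {D : Type} (p : D → Fin (G.deg v)) (z : D) :
    isMarked (fun z => (Sum.inl ⟨v, p z⟩ : G.Index)) (fun _ => G.someIndex v)
      (fun b _ => !visited b.1 && decide (G.deg b.1 ≠ 0)) (G.oracle x) z = true ↔
      G.Fresh visited v (p z) := by
  change (!visited (G.adj v (p z)) && decide (G.deg (G.adj v (p z)) ≠ 0)) = true ↔ _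
  rw [Bool.and_eq_true, Bool.not_eq_true', decide_eq_true_iff]
  rfl

theorem errorProb_detectFresh_false {a m : ℕ}
    (h : ∀ z : Fin (G.deg v), a ≤ (z : ℕ) → (z : ℕ) < a + m → ¬ G.Fresh visited v z) (r : ℕ) :
    (G.detectFresh visited v a m r).errorProb (G.oracle x) false = 0 := by
  refine errorProb_detect_false _ _ _ (fun z => ?_) r
  rw [← Bool.not_eq_true]
  exact fun h' => h z.1 z.2.1 z.2.2 ((G.isMarked_fresh x visited v Subtype.val z).1 h')

theorem errorProb_detectFresh_true {a m : ℕ} {z : Fin (G.deg v)} (ha : a ≤ (z : ℕ))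
    (hm : (z : ℕ) < a + m) (h : G.Fresh visited v z) (r : ℕ) :
    (G.detectFresh visited v a m r).errorProb (G.oracle x) true ≤ 2⁻¹ ^ r := by
  refine errorProb_detect_true _ _ _ (fun y z h => ?_) ⟨⟨z, ha, hm⟩, ?_⟩ r
  · exact Subtype.ext (G.inl_injective v h)
  · exact (G.isMarked_fresh x visited v Subtype.val _).2 h

theorem always_detectFresh (a m r : ℕ) :
    (G.detectFresh visited v a m r).Always (G.oracle x) fun _ q => (q : ℝ) ≤ 32 * (r * √m) := by
  refine (always_detect _ _ _ r).mono fun _ q hq => hq.trans ?_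
  have hcard : Fintype.card {z : Fin (G.deg v) // a ≤ (z : ℕ) ∧ (z : ℕ) < a + m} ≤ m := by
    have := Fintype.card_le_of_injective
      (fun z : {z : Fin (G.deg v) // a ≤ (z : ℕ) ∧ (z : ℕ) < a + m} =>
        (⟨z.1 - a, by have := z.2; omega⟩ : Fin m)) (by
        rintro ⟨y, hy⟩ ⟨z, hz⟩ h
        have h' : (y : ℕ) - a = z - a := by simpa using h
        refine Subtype.ext (Fin.ext ?_)
        change (y : ℕ) = z
        omega)
    simpa using this
  calc (r : ℝ) * (32 * √(Fintype.card {z : Fin (G.deg v) // a ≤ (z : ℕ) ∧ (z : ℕ) < a + m}))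
      ≤ r * (32 * √m) := by gcongr
    _ = 32 * (r * √m) := by ring

theorem sqrt_two_pow_succ_ge (k : ℕ) : 4 / 3 * √((2 : ℝ) ^ k) ≤ √(2 ^ (k + 1)) := by
  rw [pow_succ, Real.sqrt_mul (by positivity), mul_comm]
  gcongr
  rw [Real.le_sqrt (by positivity) (by positivity)]
  norm_num

theorem always_descend (k a r : ℕ) :
    (G.descend visited v k a r).Always (G.oracle x) fun o q =>
      (∀ z ∈ o, a ≤ (z : ℕ) ∧ (z : ℕ) < a + 2 ^ k ∧ G.Fresh visited v z) ∧
        (q : ℝ) ≤ 32 * (√(2 ^ k) * (4 * r + 16)) := by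
  induction k generalizing a r with
  | zero =>
    rw [Frame.descend, QProg.always_bind]
    by_cases hf : ∃ h : a < G.deg v, G.Fresh visited v ⟨a, h⟩
    · obtain ⟨h, hf⟩ := hf
      refine (G.always_detectFresh x visited v a 1 r).mono fun b q hq => ?_
      rw [QProg.always_pure, dif_pos h]
      refine ⟨fun z hz => ?_, ?_⟩
      · cases b
        · simp at hz
        · simp only [if_true, Option.mem_some_iff] at hz
          subst hz
          simp [hf]
      · simp only [Nat.cast_one, Real.sqrt_one, mul_one] at hq
        simp only [pow_zero, Real.sqrt_one, one_mul, Nat.add_zero]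
        linarith [Nat.cast_nonneg (α := ℝ) r]
    · have h0 := G.errorProb_detectFresh_false x visited v (a := a) (m := 1) (fun z h₁ h₂ h₃ => by
        have : (z : ℕ) = a := by omega
        subst this
        exact hf ⟨z.2, h₃⟩) r
      rw [QProg.errorProb_eq_zero_iff] at h0
      refine ((G.always_detectFresh x visited v a 1 r).and h0).mono fun b q hq => ?_
      rw [QProg.always_pure, hq.2]
      refine ⟨by simp, ?_⟩
      have := hq.1
      simp only [Nat.cast_one, Real.sqrt_one, mul_one] at this
      simp only [pow_zero, Real.sqrt_one, one_mul, Nat.add_zero]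
      linarith [Nat.cast_nonneg (α := ℝ) r]
  | succ k ih =>
    rw [Frame.descend, QProg.always_bind]
    refine (G.always_detectFresh x visited v a (2 ^ k) r).mono fun b q hq => ?_
    have hsq := sqrt_two_pow_succ_ge k
    have hr : (0 : ℝ) ≤ r := Nat.cast_nonneg r
    have hpow : 2 ^ (k + 1) = 2 ^ k + 2 ^ k := by ring
    have hcost : ∀ q' : ℕ, (q' : ℝ) ≤ 32 * (√(2 ^ k) * (4 * (r + 1 : ℕ) + 16)) →
        ((q + q' : ℕ) : ℝ) ≤ 32 * (√(2 ^ (k + 1)) * (4 * r + 16)) := by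
      intro q' hq'
      push_cast at hq hq' ⊢
      have : 4 / 3 * √((2 : ℝ) ^ k) * (4 * r + 16) ≤ √(2 ^ (k + 1)) * (4 * r + 16) := by gcongr
      have h0 : 0 ≤ √((2 : ℝ) ^ k) := Real.sqrt_nonneg _
      have h1 : 0 ≤ √((2 : ℝ) ^ k) * r := by positivity
      linarith
    cases b
    · refine (ih (a + 2 ^ k) (r + 1)).mono fun o q' hq' => ⟨fun z hz => ?_, hcost q' hq'.2⟩
      obtain ⟨h₁, h₂, h₃⟩ := hq'.1 z hz
      exact ⟨by omega, by omega, h₃⟩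
    · refine (ih a (r + 1)).mono fun o q' hq' => ⟨fun z hz => ?_, hcost q' hq'.2⟩
      obtain ⟨h₁, h₂, h₃⟩ := hq'.1 z hz
      exact ⟨by omega, by omega, h₃⟩

theorem errorProb_descend {z : Fin (G.deg v)} (hz : G.Fresh visited v z) (k a r : ℕ)
    (ha : a ≤ (z : ℕ)) (hk : (z : ℕ) < a + 2 ^ k)
    (hmin : ∀ y : Fin (G.deg v), a ≤ (y : ℕ) → y < z → ¬ G.Fresh visited v y) :
    (G.descend visited v k a r).errorProb (G.oracle x) (some z) ≤ 2 * 2⁻¹ ^ r := by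
  induction k generalizing a r with
  | zero =>
    have haz : a = z := by simp at hk; omega
    subst haz
    rw [Frame.descend]
    refine (QProg.errorProb_bind_le
      (G.errorProb_detectFresh_true x visited v ha hk hz r) (δ := 0) ?_).trans ?_
    · rw [dif_pos z.2, if_pos rfl, QProg.errorProb_pure]
    · rw [add_zero, two_mul]
      exact le_self_add
  | succ k ih =>
    have hpow : 2 ^ (k + 1) = 2 ^ k + 2 ^ k := by ring
    have hsum : (2 : ℝ≥0∞) * 2⁻¹ ^ (r + 1) = 2⁻¹ ^ r := by
      rw [pow_succ, mul_left_comm, ENNReal.mul_inv_cancel (by norm_num) (by norm_num), mul_one]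
    rw [Frame.descend]
    by_cases hleft : (z : ℕ) < a + 2 ^ k
    · refine (QProg.errorProb_bind_le
        (G.errorProb_detectFresh_true x visited v ha hleft hz r) (δ := 2⁻¹ ^ r) ?_).trans ?_
      · rw [if_pos rfl, ← hsum]
        exact ih a (r + 1) ha hleft hmin
      · rw [two_mul]
    · refine (QProg.errorProb_bind_le
        (G.errorProb_detectFresh_false x visited v (fun y h₁ h₂ => hmin y h₁ ?_) r).le
        (δ := 2⁻¹ ^ r) ?_).trans ?_
      · rw [Fin.lt_def]
        omega
      · rw [if_neg Bool.false_ne_true, ← hsum]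
        exact ih (a + 2 ^ k) (r + 1) (by omega) (by omega) fun y h₁ h₂ => hmin y (by omega) h₂
      · rw [two_mul, zero_add]
        exact le_self_add

/-- The number of positions that a search from `start` has accounted for when it reports `o`. -/
def searchedLength {v : Fin n} (start : ℕ) : Option (Fin (G.deg v)) → ℝ
  | some z => (z : ℝ) + 1 - start
  | none => (G.deg v : ℝ) - start

/-- The cost of the search from the block of length `2 ^ k` on. The subtracted term pays for the
shorter blocks, which have been searched before. -/
theorem always_blockSearch (start r fuel k : ℕ) :
    (G.blockSearch visited v start r fuel k).Always (G.oracle x) fun o q =>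
      (∀ z ∈ o, start ≤ (z : ℕ) ∧ G.Fresh visited v z) ∧
      (G.deg v ≤ start + 2 ^ k - 1 → o = none ∧ q = 0) ∧
      (¬ G.deg v ≤ start + 2 ^ k - 1 →
        (q : ℝ) ≤ 32 * ((8 * r + 16) * √(G.searchedLength start o) - 3 * r * √(2 ^ k))) := by
  have hr : (0 : ℝ) ≤ r := Nat.cast_nonneg r
  induction fuel generalizing k with
  | zero =>
    rw [Frame.blockSearch, QProg.always_pure]
    refine ⟨by simp, by simp, fun h => ?_⟩
    have h1 : (2 : ℝ) ^ k ≤ (G.deg v : ℝ) - start := by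
      rw [le_sub_iff_add_le]
      exact_mod_cast (by omega : 2 ^ k + start ≤ G.deg v)
    have h2 := Real.sqrt_le_sqrt h1
    have h3 := mul_le_mul_of_nonneg_left h2 hr
    simp only [searchedLength]
    have h0 : 0 ≤ √((2 : ℝ) ^ k) := Real.sqrt_nonneg _
    have h1 : 0 ≤ r * √((2 : ℝ) ^ k) := by positivity
    push_cast
    linarith
  | succ fuel ih =>
    rw [Frame.blockSearch]
    split_ifs with h
    · rw [QProg.always_pure]
      exact ⟨by simp, fun _ => ⟨rfl, rfl⟩, fun h' => (h' h).elim⟩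
    rw [QProg.always_bind]
    refine (G.always_detectFresh x visited v (start + 2 ^ k - 1) (2 ^ k) r).mono fun b q hq => ?_
    have hpow : 1 ≤ 2 ^ k := Nat.one_le_two_pow
    have hlen : (2 : ℝ) ^ k ≤ (G.deg v : ℝ) - start := by
      rw [le_sub_iff_add_le]
      exact_mod_cast (by omega : 2 ^ k + start ≤ G.deg v)
    have h0 : 0 ≤ √((2 : ℝ) ^ k) := Real.sqrt_nonneg _
    have h1 : 0 ≤ r * √((2 : ℝ) ^ k) := by positivity
    have key : ∀ l : ℝ, 2 ^ k ≤ l →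
        (8 * r + 16) * √((2 : ℝ) ^ k) ≤ (8 * r + 16) * √l := fun l hl =>
      mul_le_mul_of_nonneg_left (Real.sqrt_le_sqrt hl) (by positivity)
    cases b
    · refine (ih (k + 1)).mono fun o q' hq' => ⟨hq'.1, fun h' => (h h').elim, fun _ => ?_⟩
      by_cases hnext : G.deg v ≤ start + 2 ^ (k + 1) - 1
      · obtain ⟨rfl, rfl⟩ := hq'.2.1 hnext
        have := key _ hlen
        simp only [searchedLength]
        push_cast at hq ⊢
        linarith
      · have := hq'.2.2 hnext
        have h2 := mul_le_mul_of_nonneg_left (sqrt_two_pow_succ_ge k) hr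
        push_cast at hq ⊢
        linarith
    · refine (G.always_descend x visited v k _ r).mono fun o q' hq' =>
        ⟨fun z hz => ⟨?_, (hq'.1 z hz).2.2⟩, fun h' => (h h').elim, fun _ => ?_⟩
      · have := (hq'.1 z hz).1
        omega
      · have hl : 2 ^ k ≤ G.searchedLength start o := by
          cases o with
          | none => exact hlen
          | some z =>
            have := (hq'.1 z rfl).1
            rw [searchedLength, le_sub_iff_add_le]
            exact_mod_cast (by omega : 2 ^ k + start ≤ z + 1)
        have := key _ hl
        have h2 := hq'.2
        push_cast at hq ⊢
        linarith

theorem errorProb_blockSearch (start r fuel k : ℕ) (hfuel : G.deg v ≤ fuel + k)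
    (hmin : ∀ y : Fin (G.deg v), start ≤ (y : ℕ) → (y : ℕ) < start + 2 ^ k - 1 →
      ¬ G.Fresh visited v y) :
    (G.blockSearch visited v start r fuel k).errorProb (G.oracle x)
      (G.firstFresh visited v start) ≤ 3 * 2⁻¹ ^ r := by
  have hpast : G.deg v ≤ start + 2 ^ k - 1 → G.firstFresh visited v start = none := fun h =>
    G.firstFresh_eq_none_iff.2 fun z hz => hmin z hz (by omega)
  induction fuel generalizing k with
  | zero =>
    have : k < 2 ^ k := Nat.lt_two_pow_self
    rw [hpast (by omega), Frame.blockSearch, QProg.errorProb_pure]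
    exact zero_le
  | succ fuel ih =>
    have hpow : 1 ≤ 2 ^ k := Nat.one_le_two_pow
    rw [Frame.blockSearch]
    split_ifs with h
    · rw [hpast h, QProg.errorProb_pure]
      exact zero_le
    by_cases hb : ∃ z : Fin (G.deg v), start + 2 ^ k - 1 ≤ (z : ℕ) ∧
        (z : ℕ) < start + 2 ^ k - 1 + 2 ^ k ∧ G.Fresh visited v z
    · obtain ⟨y, hy₁, hy₂, hy₃⟩ := hb
      cases hff : G.firstFresh visited v start with
      | none => exact (G.firstFresh_eq_none_iff.1 hff y (by omega) hy₃).elim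
      | some z =>
        obtain ⟨⟨hz₁, hz₂⟩, hz₃⟩ := G.firstFresh_eq_some_iff.1 hff
        have hzy : (z : ℕ) ≤ y := by
          by_contra hlt
          exact hz₃ y (by omega) (by rw [Fin.lt_def]; omega) hy₃
        have hz₄ : start + 2 ^ k - 1 ≤ (z : ℕ) := by
          by_contra hlt
          exact hmin z hz₁ (by omega) hz₂
        refine (QProg.errorProb_bind_le
          (G.errorProb_detectFresh_true x visited v hz₄ (by omega) hz₂ r)
          (δ := 2 * 2⁻¹ ^ r) ?_).trans ?_
        · rw [if_pos rfl]
          exact G.errorProb_descend x visited v hz₂ k _ r hz₄ (by omega) fun y h₁ h₂ =>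
            hz₃ y (by omega) h₂
        · rw [← one_add_mul]
          norm_num
    · push Not at hb
      have hmin' : ∀ y : Fin (G.deg v), start ≤ (y : ℕ) → (y : ℕ) < start + 2 ^ (k + 1) - 1 →
          ¬ G.Fresh visited v y := by
        intro y h₁ h₂
        rw [pow_succ] at h₂
        by_cases h₃ : (y : ℕ) < start + 2 ^ k - 1
        · exact hmin y h₁ h₃
        · exact hb y (by omega) (by omega)
      refine (QProg.errorProb_bind_le
        (G.errorProb_detectFresh_false x visited v (a := start + 2 ^ k - 1) (m := 2 ^ k) hb r).le
        (δ := 3 * 2⁻¹ ^ r) ?_).trans (zero_add _).le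
      rw [if_neg Bool.false_ne_true]
      exact ih (k + 1) (by omega) hmin' fun h' =>
        G.firstFresh_eq_none_iff.2 fun z hz => hmin' z hz (by omega)

end AndOrNotDag

theorem two_pow_clog_bound {m : ℕ} (hm : 2 ≤ m) :
    (8 * ((2 * Nat.clog 2 m + 2 : ℕ) : ℝ) + 16) ≤ 100 * Real.log m := by
  have hc : 1 ≤ Nat.clog 2 m := Nat.clog_pos (by norm_num) hm
  have hm0 : (0 : ℝ) < m := by positivity
  have h1 : 2 ^ (Nat.clog 2 m - 1) < m := Nat.pow_pred_clog_lt_self (by norm_num) hm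
  have h2 : ((Nat.clog 2 m - 1 : ℕ) : ℝ) * Real.log 2 ≤ Real.log m := by
    rw [← Real.log_pow]
    exact Real.log_le_log (by positivity) (by exact_mod_cast h1.le)
  have h3 : Real.log 2 ≤ Real.log m := Real.log_le_log (by norm_num) (by exact_mod_cast hm)
  have h4 := Real.log_two_gt_d9
  rw [Nat.cast_sub hc] at h2
  push_cast at h2 ⊢
  nlinarith

/-- The subroutines obtained from Grover search. -/
def groverSubroutines : Subroutines where
  gate F t v := F.gateProg t v
  firstOne F visited v start := F.firstOneProg visited v start

theorem groverSubroutines_correct : groverSubroutines.Correct 3200 where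
  gate_queries G x t v _ p hp := by
    refine (G.always_gateProg x t v p hp).trans ?_
    gcongr
    norm_num
  gate_error G x t v hv := by
    refine (G.errorProb_gateProg x t v hv).trans ?_
    split_ifs
    · exact zero_le
    · exact le_rfl
  gate_one_sided G x t v hv h := by
    have := G.errorProb_gateProg x t v hv
    rw [if_pos h, h] at this
    exact le_antisymm this zero_le
  first_found G x visited v start h _ z q hq := by
    have := G.always_blockSearch x visited v start _ _ 0 (some z, q) hq
    obtain ⟨h₁, h₂⟩ := this.1 z rfl
    refine ⟨h₁, h₂, ?_⟩
    have h₃ := this.2.2 (by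
      have := z.2
      rw [pow_zero]
      omega)
    refine h₃.trans ?_
    have h₄ := mul_le_mul_of_nonneg_right (two_pow_clog_bound h)
      (Real.sqrt_nonneg ((z : ℝ) + 1 - start))
    have h₅ : 0 ≤ 3 * ((2 * Nat.clog 2 G.nhat + 2 : ℕ) : ℝ) * √(2 ^ 0) := by positivity
    change 32 * (_ * √((z : ℝ) + 1 - start) - _) ≤ _
    linarith
  first_none G x visited v start h hs q hq := by
    have := G.always_blockSearch x visited v start _ _ 0 (none, q) hq
    by_cases hpast : G.deg v ≤ start + 2 ^ 0 - 1
    · rw [show q = 0 from (this.2.1 hpast).2, Nat.cast_zero]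
      have : 0 ≤ Real.log G.nhat := Real.log_natCast_nonneg _
      positivity
    refine (this.2.2 hpast).trans ?_
    have h₄ := mul_le_mul_of_nonneg_right (two_pow_clog_bound h)
      (Real.sqrt_nonneg ((G.deg v : ℝ) - start))
    have h₅ : 0 ≤ 3 * ((2 * Nat.clog 2 G.nhat + 2 : ℕ) : ℝ) * √(2 ^ 0) := by positivity
    change 32 * (_ * √((G.deg v : ℝ) - start) - _) ≤ _
    linarith
  first_error G x visited v start h hs := by
    refine (G.errorProb_blockSearch x visited v start _ _ 0 (by omega)
      (fun y h₁ h₂ => by rw [pow_zero] at h₂; omega)).trans ?_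
    have hn : (G.nhat : ℝ) ≤ 2 ^ Nat.clog 2 G.nhat := by
      exact_mod_cast Nat.le_pow_clog (by norm_num) _
    have hn0 : (0 : ℝ) < G.nhat := by positivity
    rw [show (3 : ℝ≥0∞) * 2⁻¹ ^ (2 * Nat.clog 2 G.nhat + 2) =
      ENNReal.ofReal (3 * 2⁻¹ ^ (2 * Nat.clog 2 G.nhat + 2)) by
        rw [ENNReal.ofReal_mul (by norm_num), ENNReal.ofReal_pow (by norm_num),
          ENNReal.ofReal_inv_of_pos (by norm_num), ENNReal.ofReal_ofNat, ENNReal.ofReal_ofNat]]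
    refine ENNReal.ofReal_le_ofReal ?_
    rw [inv_pow, ← div_eq_mul_inv, div_le_div_iff₀ (by positivity) (by positivity), one_mul,
      pow_add, mul_comm 2, pow_mul]
    have := pow_le_pow_left₀ hn0.le hn 2
    nlinarith

/-! ### The depth-first search: number of queries -/

namespace Frame

variable {n : ℕ} (F : Frame n)

/-- The total weight of the visited vertices that are not sinks. -/
def visitedSum {M : Type} [AddCommMonoid M] (w : Fin n → M) (visited : Fin n → Bool) : M :=
  ∑ u with visited u = true ∧ F.deg u ≠ 0, w u

/-- The number of vertices that have not been visited. -/
def unvisitedCount (visited : Fin n → Bool) : ℕ :=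
  (Finset.univ.filter fun u => visited u = false).card

theorem visitedSum_update {M : Type} [AddCommMonoid M] (w : Fin n → M) {visited : Fin n → Bool}
    {v : Fin n} (hv : visited v = false) (hd : F.deg v ≠ 0) :
    F.visitedSum w (Function.update visited v true) = w v + F.visitedSum w visited := by
  rw [visitedSum, visitedSum, ← Finset.sum_insert (a := v) (by simp [hv])]
  congr 1
  ext u
  by_cases h : u = v
  · subst h
    simp [hd]
  · simp [h]

theorem visitedSum_update_sink {M : Type} [AddCommMonoid M] (w : Fin n → M)
    {visited : Fin n → Bool} {v : Fin n} (hd : F.deg v = 0) :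
    F.visitedSum w (Function.update visited v true) = F.visitedSum w visited := by
  rw [visitedSum, visitedSum]
  congr 1
  ext u
  by_cases h : u = v
  · subst h
    simp [hd]
  · simp [h]

theorem unvisitedCount_update {visited : Fin n → Bool} {v : Fin n} (hv : visited v = false) :
    unvisitedCount (Function.update visited v true) + 1 = unvisitedCount visited := by
  rw [unvisitedCount, unvisitedCount,
    ← Finset.card_insert_of_notMem (a := v) (by simp)]
  congr 1
  ext u
  by_cases h : u = v
  · subst h
    simp [hv]
  · simp [h]

theorem unvisitedCount_mono {visited visited' : Fin n → Bool}
    (h : ∀ u, visited u = true → visited' u = true) :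
    unvisitedCount visited' ≤ unvisitedCount visited := by
  refine Finset.card_le_card fun u hu => ?_
  simp only [Finset.mem_filter_univ] at hu ⊢
  by_contra hne
  simp [h u (by simpa using hne)] at hu

end Frame

namespace AndOrNotDag

open Subroutines Frame

variable {n N : ℕ} {S : Subroutines} {C α β : ℝ} (G : AndOrNotDag n N)

/-- What every execution of a part of the depth-first search from the memory `s` to the memory
`s'` satisfies, if it makes `q` queries: the vertices visited in between pay for the queries, up to
the balance `c`, and the order grows only by such vertices. The weights `w` are arbitrary. -/
structure QueryBound (α β : ℝ) (w : Fin n → ℝ) (c : ℝ) (s s' : Memory n) (q : ℕ) : Prop where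
  visited_mono : ∀ u, s.visited u = true → s'.visited u = true
  queries : q + G.visitedSum (fun u => α * G.deg u + 2 * β + 1) s.visited + c ≤
    G.visitedSum (fun u => α * G.deg u + 2 * β + 1) s'.visited
  order : (s'.order.map w).sum + G.visitedSum w s.visited ≤
    (s.order.map w).sum + G.visitedSum w s'.visited

variable {G} in
theorem QueryBound.refl {w : Fin n → ℝ} {c : ℝ} (hc : c ≤ 0) (s : Memory n) :
    G.QueryBound α β w c s s 0 :=
  ⟨fun _ h => h, by push_cast; linarith, le_rfl⟩

variable {G} in
theorem QueryBound.trans {w : Fin n → ℝ} {c c' : ℝ} {s s' s'' : Memory n} {q q' : ℕ}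
    (h : G.QueryBound α β w c s s' q) (h' : G.QueryBound α β w c' s' s'' q') :
    G.QueryBound α β w (c + c') s s'' (q + q') where
  visited_mono u hu := h'.visited_mono u (h.visited_mono u hu)
  queries := by
    have h₁ := h.queries
    have h₂ := h'.queries
    push_cast
    linarith
  order := by
    have h₁ := h.order
    have h₂ := h'.order
    linarith

variable [NeZero n] (x : Fin N → Bool)

/-- The loop over an adjacency list, the remaining part of which pays for all searches but the
last one; each successful search is also charged to the vertex it finds. -/
theorem always_scan (hS : S.Correct C) (hn : 2 ≤ G.nhat) (hα : 0 ≤ α) (hβ : 0 ≤ β)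
    (hcost : ∀ l : ℝ, 0 ≤ l → C * √l * Real.log G.nhat ≤ α * l + β) {w : Fin n → ℝ} {depth : ℕ}
    {visit : Fin n → Memory n → G.Prog (Memory n)}
    (hvisit : ∀ u s, unvisitedCount s.visited ≤ depth → s.visited u = false → G.deg u ≠ 0 →
      (visit u s).Always (G.oracle x) (G.QueryBound α β w (β + 1) s))
    (v : Fin n) (rounds start : ℕ) (s : Memory n) (hs : start ≤ G.deg v)
    (hdepth : unvisitedCount s.visited ≤ depth) :
    (S.scan G.toFrame visit v rounds start s).Always (G.oracle x)
      (G.QueryBound α β w (-(α * ((G.deg v : ℝ) - start) + β)) s) := by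
  induction rounds generalizing start s with
  | zero =>
    rw [scan, QProg.always_pure]
    refine QueryBound.refl ?_ s
    have : (0 : ℝ) ≤ (G.deg v : ℝ) - start := sub_nonneg.2 (by exact_mod_cast hs)
    have := mul_nonneg hα this
    linarith
  | succ rounds ih =>
    rw [scan, QProg.always_bind]
    rintro ⟨o, q⟩ ho
    cases o with
    | none =>
      have hq := (hS.first_none G x s.visited v start hn hs q ho).trans
        (hcost _ (sub_nonneg.2 (by exact_mod_cast hs)))
      rw [QProg.always_pure]
      exact ⟨fun _ h => h, by push_cast; linarith, le_rfl⟩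
    | some z =>
      obtain ⟨hz, hf, hq⟩ := hS.first_found G x s.visited v start hn hs z q ho
      have hz' : (start : ℝ) ≤ z := by exact_mod_cast hz
      replace hq := hq.trans (hcost _ (by linarith))
      simp only [QProg.always_bind, QProg.always_read]
      refine (hvisit _ s hdepth hf.1 hf.2).mono fun s₁ q₁ h₁ => ?_
      refine (ih (z + 1) s₁ z.2 ((unvisitedCount_mono h₁.visited_mono).trans hdepth)).mono
        fun s₂ q₂ h₂ => ?_
      have h := h₁.trans h₂
      refine ⟨h.visited_mono, ?_, h.order⟩
      have := h.queries
      push_cast at this ⊢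
      linarith

theorem always_topSortDFS (hS : S.Correct C) (hn : 2 ≤ G.nhat) (hα : 0 ≤ α) (hβ : 0 ≤ β)
    (hcost : ∀ l : ℝ, 0 ≤ l → C * √l * Real.log G.nhat ≤ α * l + β) (w : Fin n → ℝ) (depth : ℕ)
    (v : Fin n) (s : Memory n) (hdepth : unvisitedCount s.visited ≤ depth)
    (hv : s.visited v = false) (hd : G.deg v ≠ 0) :
    (S.topSortDFS G.toFrame depth v s).Always (G.oracle x) (G.QueryBound α β w (β + 1) s) := by
  induction depth generalizing v s with
  | zero =>
    have := unvisitedCount_update hv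
    omega
  | succ depth ih =>
    rw [topSortDFS, if_neg hd, QProg.always_bind]
    refine (G.always_scan x hS hn hα hβ hcost (w := w) (depth := depth)
      (fun u s h₁ h₂ h₃ => ih u s h₁ h₂ h₃) v _ 0 _ (Nat.zero_le _) ?_).mono fun s₂ q h => ?_
    · have := unvisitedCount_update hv
      change unvisitedCount (Function.update s.visited v true) ≤ _
      omega
    · rw [QProg.always_pure]
      have h₁ := h.visited_mono
      have h₂ := h.queries
      have h₃ := h.order
      dsimp only at h₁ h₂ h₃
      rw [G.visitedSum_update _ hv hd] at h₂ h₃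
      refine ⟨fun u hu => h₁ u ?_, ?_, ?_⟩
      · by_cases huv : u = v
        · simp [huv]
        · simpa [huv] using hu
      · push_cast at h₂ ⊢
        linarith
      · simp only [List.map_cons, List.sum_cons]
        linarith

theorem topSortDFS_sink (F : Frame n) {depth : ℕ} (hdepth : depth ≠ 0) {v : Fin n}
    (hd : F.deg v = 0) (s : Memory n) :
    S.topSortDFS F depth v s =
      pure { s with visited := Function.update s.visited v true } := by
  cases depth with
  | zero => exact (hdepth rfl).elim
  | succ depth => rw [topSortDFS, if_pos hd]

theorem always_topSort (hS : S.Correct C) (hn : 2 ≤ G.nhat) (hα : 0 ≤ α) (hβ : 0 ≤ β)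
    (hcost : ∀ l : ℝ, 0 ≤ l → C * √l * Real.log G.nhat ≤ α * l + β) {w : Fin n → ℝ}
    (hw : ∀ v, 0 ≤ w v) (starts : List (Fin n)) :
    (S.topSort G.toFrame starts).Always (G.oracle x) fun order q =>
      (q : ℝ) ≤ ∑ u with G.deg u ≠ 0, (α * G.deg u + 2 * β + 1) ∧
        (order.map w).sum ≤ ∑ u with G.deg u ≠ 0, w u := by
  have hloop : ∀ (l : List (Fin n)) (s : Memory n),
      (l.foldlM (init := s) fun (s : Memory n) v =>
        if s.visited v then (pure s : G.Prog (Memory n))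
        else S.topSortDFS G.toFrame n v s).Always (G.oracle x) (G.QueryBound α β w 0 s) := by
    intro l
    induction l with
    | nil =>
      intro s
      rw [List.foldlM_nil, QProg.always_pure]
      exact QueryBound.refl le_rfl s
    | cons v l ih =>
      intro s
      rw [List.foldlM_cons, QProg.always_bind]
      have hstep : (if s.visited v then (pure s : G.Prog (Memory n))
          else S.topSortDFS G.toFrame n v s).Always (G.oracle x) (G.QueryBound α β w 0 s) := by
        split_ifs with hv
        · rw [QProg.always_pure]
          exact QueryBound.refl le_rfl s
        · by_cases hd : G.deg v = 0
          · rw [topSortDFS_sink _ (NeZero.ne n) hd, QProg.always_pure]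
            refine ⟨fun u hu => ?_, ?_, ?_⟩
            · by_cases huv : u = v
              · simp [huv]
              · simpa [huv] using hu
            · rw [G.visitedSum_update_sink _ hd]
              simp
            · rw [G.visitedSum_update_sink _ hd]
          · refine (G.always_topSortDFS x hS hn hα hβ hcost w n v s
              ((Finset.card_le_univ _).trans_eq (Fintype.card_fin n)) (by simpa using hv) hd).mono
              fun s' q h => ⟨h.visited_mono, ?_, h.order⟩
            have := h.queries
            linarith
      refine hstep.mono fun s₁ q₁ h₁ => (ih s₁).mono fun s₂ q₂ h₂ => ?_
      simpa using h₁.trans h₂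
  have hle : ∀ {w : Fin n → ℝ}, (∀ v, 0 ≤ w v) → ∀ visited : Fin n → Bool,
      G.visitedSum w visited ≤ ∑ u with G.deg u ≠ 0, w u := fun hw visited =>
    Finset.sum_le_sum_of_subset_of_nonneg
      (fun u hu => by simp only [Finset.mem_filter_univ] at hu ⊢; exact hu.2) fun u _ _ => hw u
  have hzero : ∀ w : Fin n → ℝ, G.visitedSum w (fun _ => false) = 0 := fun w => by
    simp [visitedSum]
  rw [topSort, QProg.always_bind]
  refine (hloop starts _).mono fun s q h => ?_
  rw [QProg.always_pure]
  have h₁ := h.queries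
  have h₂ := h.order
  rw [hzero] at h₁ h₂
  simp only [List.map_nil, List.sum_nil, zero_add, add_zero] at h₁ h₂
  exact ⟨h₁.trans (hle (fun v => by positivity) _), h₂.trans (hle hw _)⟩

end AndOrNotDag

/-! ### The depth-first search: the order it finds -/

namespace AndOrNotDag

open Subroutines Frame

variable {n N : ℕ} {S : Subroutines} {C : ℝ} (G : AndOrNotDag n N)

/-- Every out-neighbour of a member of the list that is not a sink is a later member: going
backwards through the list, the arguments of each gate are known in time. -/
def Closed : List (Fin n) → Prop
  | [] => True
  | v :: l => (∀ z, G.deg (G.adj v z) ≠ 0 → G.adj v z ∈ l) ∧ Closed l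

variable {G} in
theorem Closed.adj_mem {l : List (Fin n)} (hl : G.Closed l) {v : Fin n} (hv : v ∈ l)
    (z : Fin (G.deg v)) (hz : G.deg (G.adj v z) ≠ 0) : G.adj v z ∈ l := by
  induction l with
  | nil => simp at hv
  | cons u l ih =>
    rcases List.mem_cons.1 hv with rfl | h
    · exact List.mem_cons_of_mem _ (hl.1 z hz)
    · exact List.mem_cons_of_mem _ (ih hl.2 h)

variable {G} in
theorem Closed.dropWhile {l : List (Fin n)} (hl : G.Closed l) (p : Fin n → Bool) :
    G.Closed (l.dropWhile p) := by
  induction l with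
  | nil => exact hl
  | cons v l ih =>
    rw [List.dropWhile_cons]
    split_ifs
    · exact ih hl.2
    · exact hl

/-- The vertices whose search is under way: visited, but not yet in the order. -/
def Active (s : Memory n) (u : Fin n) : Prop :=
  G.deg u ≠ 0 ∧ s.visited u = true ∧ u ∉ s.order

/-- What a part of the depth-first search from `s` to `s'` achieves if all its searches succeed. -/
structure Extends (s s' : Memory n) : Prop where
  visited_mono : ∀ u, s.visited u = true → s'.visited u = true
  closed : G.Closed s'.order
  active : ∀ u, G.Active s' u → G.Active s u
  length : s'.order.length + G.visitedSum (fun _ => 1) s.visited ≤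
    s.order.length + G.visitedSum (fun _ => 1) s'.visited

variable {G} in
theorem Extends.refl {s : Memory n} (h : G.Closed s.order) : G.Extends s s :=
  ⟨fun _ h => h, h, fun _ h => h, le_rfl⟩

variable {G} in
theorem Extends.trans {s s' s'' : Memory n} (h : G.Extends s s') (h' : G.Extends s' s'') :
    G.Extends s s'' where
  visited_mono u hu := h'.visited_mono u (h.visited_mono u hu)
  closed := h'.closed
  active u hu := h.active u (h'.active u hu)
  length := by
    have h₁ := h.length
    have h₂ := h'.length
    omega

/-- Every vertex that is not a sink is found from the vertices of in-degree zero. -/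
theorem mem_of_closed {l starts : List (Fin n)} (hl : G.Closed l)
    (hstarts : ∀ v, G.IsSource v → v ∈ starts) (h : ∀ v ∈ starts, G.deg v ≠ 0 → v ∈ l) (v : Fin n)
    (hv : G.deg v ≠ 0) : v ∈ l := by
  have hwf : WellFounded G.Edge := by
    have : IsTrans (Fin n) (Relation.TransGen G.Edge) := ⟨fun _ _ _ => Relation.TransGen.trans⟩
    have : Std.Irrefl (Relation.TransGen G.Edge) := ⟨G.acyclic⟩
    exact Subrelation.wf (fun h' => Relation.TransGen.single h')
      (Finite.wellFounded_of_trans_of_irrefl (Relation.TransGen G.Edge))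
  induction v using hwf.induction with
  | h v ih =>
    by_cases hs : G.IsSource v
    · exact h v (hstarts v hs) hv
    · unfold IsSource at hs
      push Not at hs
      obtain ⟨u, z, rfl⟩ := hs
      exact hl.adj_mem (ih u ⟨z, rfl⟩ fun h0 => by have := z.2; omega) z hv

variable [NeZero n] (x : Fin N → Bool)

/-- The bound `1 / nhat²` on the error probability of one search for a fresh position, which is also
one for a repeated gate. -/
abbrev searchError : ℝ≥0∞ := ENNReal.ofReal (1 / (G.nhat : ℝ) ^ 2)

/-- If all searches succeed, the loop over the adjacency list of `v` visits all out-neighbours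
that are not sinks. The number `c` of searches is at most one more than twice the
number of newly visited vertices. -/
theorem exists_errorProb_scan (hS : S.Correct C) (hn : 2 ≤ G.nhat) {depth : ℕ}
    {visit : Fin n → Memory n → G.Prog (Memory n)}
    (hvisit : ∀ u s, unvisitedCount s.visited ≤ depth → s.visited u = false → G.deg u ≠ 0 →
      G.Closed s.order → (∀ a, G.Active s a → Relation.TransGen G.Edge a u) →
      ∃ (s' : Memory n) (c : ℕ), (visit u s).errorProb (G.oracle x) s' ≤ c * G.searchError ∧
        G.Extends s s' ∧ s'.visited u = true ∧
        c + 1 + 2 * G.visitedSum (fun _ => 1) s.visited ≤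
          2 * G.visitedSum (fun _ => 1) s'.visited)
    (v : Fin n) (rounds start : ℕ) (s : Memory n) (hrounds : G.deg v + 1 ≤ rounds + start)
    (hs : start ≤ G.deg v) (hdepth : unvisitedCount s.visited ≤ depth) (hclosed : G.Closed s.order)
    (hactive : ∀ a, G.Active s a → Relation.ReflTransGen G.Edge a v)
    (hbefore : ∀ z : Fin (G.deg v), (z : ℕ) < start → ¬ G.Fresh s.visited v z) :
    ∃ (s' : Memory n) (c : ℕ), (S.scan G.toFrame visit v rounds start s).errorProb (G.oracle x) s' ≤
        c * G.searchError ∧ G.Extends s s' ∧ (∀ z, ¬ G.Fresh s'.visited v z) ∧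
        c + 2 * G.visitedSum (fun _ => 1) s.visited ≤
          2 * G.visitedSum (fun _ => 1) s'.visited + 1 := by
  induction rounds generalizing start s with
  | zero => omega
  | succ rounds ih =>
    have herr := hS.first_error G x s.visited v start hn hs
    rw [scan]
    cases hff : G.firstFresh s.visited v start with
    | none =>
      rw [hff] at herr
      refine ⟨s, 1, ?_, Extends.refl hclosed, fun z => ?_, by omega⟩
      · refine (QProg.errorProb_bind_le herr (δ := 0) ?_).trans (by simp)
        rw [QProg.errorProb_pure]
      · by_cases hz : start ≤ (z : ℕ)
        · exact G.firstFresh_eq_none_iff.1 hff z hz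
        · exact hbefore z (by omega)
    | some z =>
      rw [hff] at herr
      obtain ⟨⟨hz, hfresh⟩, hmin⟩ := G.firstFresh_eq_some_iff.1 hff
      obtain ⟨s₁, c₁, he₁, hext₁, hvis₁, hc₁⟩ := hvisit (G.adj v z) s hdepth hfresh.1 hfresh.2
        hclosed fun a ha => Relation.TransGen.tail' (hactive a ha) ⟨z, rfl⟩
      obtain ⟨s₂, c₂, he₂, hext₂, hall, hc₂⟩ := ih (z + 1) s₁ (by omega) z.2
        ((unvisitedCount_mono hext₁.visited_mono).trans hdepth) hext₁.closed
        (fun a ha => hactive a (hext₁.active a ha)) (fun y hy hf => by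
          have hys : s.visited (G.adj v y) = false := by
            by_contra hne
            have := hext₁.visited_mono _ (by simpa using hne)
            rw [hf.1] at this
            exact absurd this (by simp)
          rcases Nat.lt_or_ge y start with h₁ | h₁
          · exact hbefore y h₁ ⟨hys, hf.2⟩
          rcases Nat.lt_or_ge y z with h₂ | h₂
          · exact hmin y h₁ h₂ ⟨hys, hf.2⟩
          · have : y = z := Fin.ext (by omega)
            subst this
            rw [hf.1] at hvis₁
            exact absurd hvis₁ (by simp))
      refine ⟨s₂, 1 + c₁ + c₂, ?_, hext₁.trans hext₂, hall, by omega⟩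
      have hrest : (QProg.read (I := G.Index) (Z := Frame.Answer n) (Sum.inl ⟨v, z⟩) >>= fun a =>
          visit a.1 s >>= fun s' => S.scan G.toFrame visit v rounds ((z : ℕ) + 1) s').errorProb
            (G.oracle x) s₂ ≤ 0 + (c₁ * G.searchError + c₂ * G.searchError) := by
        refine QProg.errorProb_bind_le
          (QProg.errorProb_read (G.oracle x) (Sum.inl ⟨v, z⟩)).le ?_
        exact QProg.errorProb_bind_le he₁ he₂
      refine (QProg.errorProb_bind_le herr
        (δ := 0 + (c₁ * G.searchError + c₂ * G.searchError)) ?_).trans (le_of_eq ?_)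
      · exact hrest
      · push_cast
        ring

theorem exists_errorProb_topSortDFS (hS : S.Correct C) (hn : 2 ≤ G.nhat) (depth : ℕ) (v : Fin n)
    (s : Memory n) (hdepth : unvisitedCount s.visited ≤ depth) (hv : s.visited v = false)
    (hd : G.deg v ≠ 0) (hclosed : G.Closed s.order)
    (hactive : ∀ a, G.Active s a → Relation.TransGen G.Edge a v) :
    ∃ (s' : Memory n) (c : ℕ), (S.topSortDFS G.toFrame depth v s).errorProb (G.oracle x) s' ≤
        c * G.searchError ∧ G.Extends s s' ∧ s'.visited v = true ∧
        c + 1 + 2 * G.visitedSum (fun _ => 1) s.visited ≤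
          2 * G.visitedSum (fun _ => 1) s'.visited := by
  induction depth generalizing v s with
  | zero =>
    have := unvisitedCount_update hv
    omega
  | succ depth ih =>
    have hcount := unvisitedCount_update hv
    have hsum := G.visitedSum_update (fun _ => 1) hv hd
    -- the active vertices of the loop are those from before and `v`
    have hactive₁ : ∀ a, G.Active ⟨Function.update s.visited v true, s.order⟩ a →
        a = v ∨ G.Active s a := by
      rintro a ⟨h₁, h₂, h₃⟩
      by_cases hav : a = v
      · exact Or.inl hav
      · exact Or.inr ⟨h₁, by simpa [hav] using h₂, h₃⟩
    have hanc : ∀ a, G.Active ⟨Function.update s.visited v true, s.order⟩ a →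
        Relation.ReflTransGen G.Edge a v := by
      intro a ha
      rcases hactive₁ a ha with rfl | h
      · exact Relation.ReflTransGen.refl
      · exact (hactive a h).to_reflTransGen
    obtain ⟨s₂, c, herr, hext, hall, hc⟩ := G.exists_errorProb_scan x hS hn (depth := depth) ih v
      (G.deg v + 1) 0 ⟨Function.update s.visited v true, s.order⟩ (by omega) (by omega)
      (by change unvisitedCount (Function.update s.visited v true) ≤ _; omega) hclosed hanc
      (fun z hz => by omega)
    have hvv : s₂.visited v = true := hext.visited_mono v (by simp)
    have hlen := hext.length
    dsimp only at hlen hc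
    refine ⟨⟨s₂.visited, v :: s₂.order⟩, c, ?_, ⟨fun u hu => hext.visited_mono u ?_,
      ⟨fun z hz => ?_, hext.closed⟩, ?_, ?_⟩, hvv, ?_⟩
    · rw [topSortDFS, if_neg hd]
      refine (QProg.errorProb_bind_le herr (δ := 0) ?_).trans (add_zero _).le
      rw [QProg.errorProb_pure]
    · by_cases huv : u = v
      · simp [huv]
      · simpa [huv] using hu
    · -- an active out-neighbour of `v` would lie on a cycle
      by_contra hmem
      have hvis : s₂.visited (G.adj v z) = true := by
        by_contra hne
        exact hall z ⟨by simpa using hne, hz⟩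
      exact G.acyclic v
        (Relation.TransGen.head' ⟨z, rfl⟩ (hanc _ (hext.active _ ⟨hz, hvis, hmem⟩)))
    · rintro a ⟨h₁, h₂, h₃⟩
      rw [List.mem_cons, not_or] at h₃
      exact (hactive₁ a (hext.active a ⟨h₁, h₂, h₃.2⟩)).resolve_left h₃.1
    · simp only [List.length_cons]
      omega
    · dsimp only
      omega

theorem exists_errorProb_topSort (hS : S.Correct C) (hn : 2 ≤ G.nhat) {starts : List (Fin n)}
    (hstarts : ∀ v, G.IsSource v → v ∈ starts) :
    ∃ order, (S.topSort G.toFrame starts).errorProb (G.oracle x) order ≤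
        (2 * G.nhat : ℕ) * G.searchError ∧ G.Closed order ∧ order.length ≤ G.nhat ∧
        ∀ v, G.deg v ≠ 0 → v ∈ order := by
  have hloop : ∀ (l : List (Fin n)) (s : Memory n), G.Closed s.order →
      (∀ a, ¬ G.Active s a) → ∃ (s' : Memory n) (c : ℕ),
      (l.foldlM (init := s) fun (s : Memory n) v =>
        if s.visited v then (pure s : G.Prog (Memory n))
        else S.topSortDFS G.toFrame n v s).errorProb (G.oracle x) s' ≤ c * G.searchError ∧
      G.Extends s s' ∧ (∀ v ∈ l, s'.visited v = true) ∧
      c + 2 * G.visitedSum (fun _ => 1) s.visited ≤ 2 * G.visitedSum (fun _ => 1) s'.visited := by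
    intro l
    induction l with
    | nil =>
      intro s hs _
      refine ⟨s, 0, ?_, Extends.refl hs, by simp, by omega⟩
      rw [List.foldlM_nil, QProg.errorProb_pure]
      exact zero_le
    | cons v l ih =>
      intro s hs ha
      have hstep : ∃ (s' : Memory n) (c : ℕ), (if s.visited v then (pure s : G.Prog (Memory n))
          else S.topSortDFS G.toFrame n v s).errorProb (G.oracle x) s' ≤ c * G.searchError ∧
          G.Extends s s' ∧ s'.visited v = true ∧ c + 2 * G.visitedSum (fun _ => 1) s.visited ≤
            2 * G.visitedSum (fun _ => 1) s'.visited := by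
        split_ifs with hv
        · refine ⟨s, 0, ?_, Extends.refl hs, hv, by omega⟩
          rw [QProg.errorProb_pure]
          exact zero_le
        by_cases hd : G.deg v = 0
        · have hsum := G.visitedSum_update_sink (fun _ => 1) (visited := s.visited) hd
          refine ⟨⟨Function.update s.visited v true, s.order⟩, 0, ?_,
            ⟨fun u hu => ?_, hs, ?_, ?_⟩, by simp, ?_⟩
          · rw [topSortDFS_sink _ (NeZero.ne n) hd, QProg.errorProb_pure]
            exact zero_le
          · by_cases huv : u = v
            · simp [huv]
            · simpa [huv] using hu
          · rintro a ⟨h₁, h₂, h₃⟩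
            have hav : a ≠ v := fun h => h₁ (h ▸ hd)
            exact ⟨h₁, by simpa [hav] using h₂, h₃⟩
          · dsimp only
            omega
          · dsimp only
            omega
        · obtain ⟨s', c, h₁, h₂, h₃, h₄⟩ := G.exists_errorProb_topSortDFS x hS hn n v s
            ((Finset.card_le_univ _).trans_eq (Fintype.card_fin n)) (by simpa using hv) hd hs
            fun a h => (ha a h).elim
          exact ⟨s', c, h₁, h₂, h₃, by omega⟩
      obtain ⟨s₁, c₁, he₁, hext₁, hv₁, hc₁⟩ := hstep
      obtain ⟨s₂, c₂, he₂, hext₂, hv₂, hc₂⟩ := ih s₁ hext₁.closed fun a h => ha a (hext₁.active a h)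
      refine ⟨s₂, c₁ + c₂, ?_, hext₁.trans hext₂, ?_, by omega⟩
      · rw [List.foldlM_cons]
        refine (QProg.errorProb_bind_le he₁ (δ := c₂ * G.searchError) ?_).trans (le_of_eq ?_)
        · exact he₂
        · push_cast
          ring
      · intro u hu
        rcases List.mem_cons.1 hu with rfl | h
        · exact hext₂.visited_mono _ hv₁
        · exact hv₂ u h
  obtain ⟨s, c, herr, hext, hvis, hc⟩ := hloop starts ⟨fun _ => false, []⟩ trivial
    (fun a h => by simpa using h.2.1)
  have hzero : G.visitedSum (fun _ => 1) (fun _ : Fin n => false) = 0 := by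
    simp [visitedSum]
  have hle : G.visitedSum (fun _ => 1) s.visited ≤ G.nhat := by
    rw [visitedSum, ← Finset.card_eq_sum_ones]
    exact Finset.card_le_card fun u hu => by
      simp only [Finset.mem_filter_univ] at hu ⊢
      exact hu.2
  have hlen := hext.length
  simp only [List.length_nil] at hlen hc
  rw [hzero] at hlen hc
  refine ⟨s.order, ?_, hext.closed, by omega, G.mem_of_closed hext.closed hstarts fun v hv hd => ?_⟩
  · rw [topSort]
    refine (QProg.errorProb_bind_le herr (δ := 0) ?_).trans ?_
    · rw [QProg.errorProb_pure]
    · rw [add_zero]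
      gcongr
      omega
  · by_contra hmem
    simpa using (hext.active v ⟨hd, hvis v hv, hmem⟩).2.1

end AndOrNotDag

/-! ### The evaluation -/

namespace QProg

variable {I Z : Type} [Fintype I] [DecidableEq I] [Fintype Z] [DecidableEq Z] [AddCommGroup Z]
  {α : Type}

theorem always_replicate {x : I → Z} {P : QProg I Z α} {c : ℝ}
    (h : P.Always x fun _ q => (q : ℝ) ≤ c) (k : ℕ) :
    (P.replicate k).Always x fun _ q => (q : ℝ) ≤ k * c := by
  induction k with
  | zero => simp [replicate, always_pure]
  | succ k ih =>
    rw [replicate]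
    simp only [always_bind, always_pure]
    refine h.mono fun a q hq => ih.mono fun l q' hq' => ?_
    push_cast
    linarith

theorem always_all_replicate {x : I → Z} {P : QProg I Z α} {a : α} (h : P.errorProb x a = 0)
    (k : ℕ) : (P.replicate k).Always x fun l _ => ∀ b ∈ l, b = a := by
  rw [errorProb_eq_zero_iff] at h
  induction k with
  | zero => simp [replicate, always_pure]
  | succ k ih =>
    rw [replicate]
    simp only [always_bind, always_pure]
    refine h.mono fun b q hb => ih.mono fun l q' hl => ?_
    simpa [hb] using hl

/-- The gate finds a decisive argument unless all runs have missed it. -/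
theorem errorProb_replicate_gate (x : I → Z) (P : QProg I Z Bool) (g : Gate) (k : ℕ) :
    (do
      let l ← P.replicate k
      pure (g.eval l) : QProg I Z Bool).errorProb x (!g.neutral) ≤
        P.errorProb x (!g.neutral) ^ k := by
  induction k with
  | zero => simpa using errorProb_le_one _ _ _
  | succ k ih =>
    have hP : P.errorProb x (!g.neutral) = P.dist x g.neutral := by
      rw [errorProb_eq, show {b : Bool | b ≠ !g.neutral} = {g.neutral} by
        ext b; cases b <;> cases g.neutral <;> simp, PMF.toOuterMeasure_apply_singleton]
    have hcons : ∀ (b : Bool) (l : List Bool),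
        g.eval (b :: l) = if b = g.neutral then g.eval l else !g.neutral := by
      intro b l
      cases g <;> cases b <;> simp [Gate.eval, Gate.neutral]
    have hmiss : ∀ b : Bool, b ≠ g.neutral →
        (do
          let l ← P.replicate k
          pure (g.eval (b :: l)) : QProg I Z Bool).errorProb x (!g.neutral) = 0 := by
      intro b hb
      rw [errorProb_eq_zero_iff, always_bind]
      intro p _
      rw [always_pure, hcons, if_neg hb]
    rw [replicate]
    simp only [bind_assoc, pure_bind]
    rw [errorProb_bind, tsum_eq_single g.neutral fun b hb => by rw [hmiss b hb, mul_zero]]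
    simp only [hcons, if_true]
    rw [pow_succ', ← hP]
    gcongr

end QProg

namespace AndOrNotDag

open Subroutines Frame

variable {n N : ℕ} [NeZero n] {S : Subroutines} {C : ℝ} (G : AndOrNotDag n N)
  (x : Fin N → Bool)

omit [NeZero n] in
theorem value_eq_eval_arg (t : Fin n → Bool) (v : Fin n) (hv : G.deg v ≠ 0)
    (ht : ∀ z, G.deg (G.adj v z) ≠ 0 → t (G.adj v z) = G.value x (G.adj v z)) :
    (G.gate ⟨v, hv⟩).eval (List.ofFn (G.arg x t v)) = G.value x v := by
  rw [value_eq, dif_neg hv]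
  congr 2
  funext z
  rw [arg]
  split_ifs with h
  · rw [G.value_eq x (G.adj v z), dif_pos h]
  · rw [ht z h]

theorem always_boostedGate (hS : S.Correct C) (t : Fin n → Bool) (v : Fin n) (hv : G.deg v ≠ 0) :
    (S.boostedGate G.toFrame t ⟨v, hv⟩).Always (G.oracle x) fun _ q =>
      (q : ℝ) ≤ ⌈2 * Real.logb 2 G.nhat⌉₊ * (C * √(G.deg v)) := by
  rw [boostedGate, QProg.always_bind]
  refine (QProg.always_replicate (hS.gate_queries G x t v hv) _).mono fun l q hq => ?_
  rw [QProg.always_pure]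
  simpa using hq

theorem errorProb_boostedGate (hS : S.Correct C) (hn : 2 ≤ G.nhat) (t : Fin n → Bool) (v : Fin n)
    (hv : G.deg v ≠ 0) :
    (S.boostedGate G.toFrame t ⟨v, hv⟩).errorProb (G.oracle x)
      ((G.gate ⟨v, hv⟩).eval (List.ofFn (G.arg x t v))) ≤ G.searchError := by
  rw [boostedGate]
  by_cases h : (G.gate ⟨v, hv⟩).eval (List.ofFn (G.arg x t v)) = (G.gate ⟨v, hv⟩).neutral
  · have hall := QProg.always_all_replicate (hS.gate_one_sided G x t v hv h)
      ⌈2 * Real.logb 2 G.nhat⌉₊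
    refine le_trans (le_of_eq ?_) zero_le
    rw [QProg.errorProb_eq_zero_iff, QProg.always_bind, h]
    refine hall.mono fun l q hl => ?_
    rw [QProg.always_pure]
    cases hg : G.gate ⟨v, hv⟩ <;> simp_all [Gate.eval, Gate.neutral]
  · have hne : (G.gate ⟨v, hv⟩).eval (List.ofFn (G.arg x t v)) = !(G.gate ⟨v, hv⟩).neutral := by
      revert h
      cases (G.gate ⟨v, hv⟩).eval (List.ofFn (G.arg x t v)) <;>
        cases (G.gate ⟨v, hv⟩).neutral <;> simp
    have herr := hS.gate_error G x t v hv
    rw [hne] at herr ⊢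
    refine (QProg.errorProb_replicate_gate _ _ _ _).trans ?_
    refine (pow_le_pow_left' herr _).trans ?_
    rw [show (1 / 2 : ℝ≥0∞) = ENNReal.ofReal 2⁻¹ by
        rw [ENNReal.ofReal_inv_of_pos two_pos, ENNReal.ofReal_ofNat, one_div],
      ← ENNReal.ofReal_pow (by norm_num)]
    refine ENNReal.ofReal_le_ofReal ?_
    have hn0 : (0 : ℝ) < G.nhat := by positivity
    rw [inv_pow, one_div]
    gcongr
    rw [← Real.rpow_natCast 2]
    calc (G.nhat : ℝ) ^ 2 = (2 : ℝ) ^ (2 * Real.logb 2 G.nhat) := by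
          rw [mul_comm, Real.rpow_mul (by norm_num),
            Real.rpow_logb (by norm_num) (by norm_num) hn0]
          norm_cast
      _ ≤ _ := Real.rpow_le_rpow_of_exponent_le (by norm_num) (Nat.le_ceil _)

/-- One step of the evaluation. -/
abbrev evalStep (S : Subroutines) (t : Fin n → Bool) (v : Fin n) : G.Prog (Fin n → Bool) :=
  if h : G.deg v ≠ 0 then do
    let b ← S.boostedGate G.toFrame t ⟨v, h⟩
    pure (Function.update t v b)
  else (pure t : G.Prog (Fin n → Bool))

theorem always_evalLoop (hS : S.Correct C) (hC : 0 ≤ C) (l : List (Fin n)) (t : Fin n → Bool) :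
    (l.foldlM (G.evalStep S) t).Always (G.oracle x) fun _ q =>
      (q : ℝ) ≤ (l.map fun v => ⌈2 * Real.logb 2 G.nhat⌉₊ * (C * √(G.deg v))).sum := by
  induction l generalizing t with
  | nil =>
    rw [List.foldlM_nil, QProg.always_pure]
    simp
  | cons v l ih =>
    have hstep : (G.evalStep S t v).Always (G.oracle x) fun _ q =>
        (q : ℝ) ≤ ⌈2 * Real.logb 2 G.nhat⌉₊ * (C * √(G.deg v)) := by
      unfold evalStep
      split_ifs with h
      · rw [QProg.always_bind]
        refine (G.always_boostedGate x hS t v h).mono fun b q hq => ?_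
        rw [QProg.always_pure]
        simpa using hq
      · rw [QProg.always_pure, Nat.cast_zero]
        positivity
    rw [List.foldlM_cons, QProg.always_bind]
    refine hstep.mono fun t' q hq => (ih t').mono fun _ q' hq' => ?_
    rw [List.map_cons, List.sum_cons]
    push_cast
    linarith

theorem exists_errorProb_evalLoop (hS : S.Correct C) (hn : 2 ≤ G.nhat) {l : List (Fin n)}
    (hl : G.Closed l) :
    ∃ t, (l.reverse.foldlM (G.evalStep S) fun _ => false).errorProb (G.oracle x) t ≤
      l.length * G.searchError ∧ ∀ v ∈ l, G.deg v ≠ 0 → t v = G.value x v := by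
  induction l with
  | nil =>
    refine ⟨fun _ => false, ?_, by simp⟩
    rw [List.reverse_nil, List.foldlM_nil, QProg.errorProb_pure]
    exact zero_le
  | cons v l ih =>
    obtain ⟨t, herr, ht⟩ := ih hl.2
    by_cases hv : G.deg v = 0
    · refine ⟨t, ?_, fun u hu hd => ht u ((List.mem_cons.1 hu).resolve_left fun h => ?_) hd⟩
      · rw [List.reverse_cons, List.foldlM_append]
        refine (QProg.errorProb_bind_le herr (δ := 0) ?_).trans ?_
        · rw [List.foldlM_cons, evalStep, dif_neg (by simpa using hv), pure_bind, List.foldlM_nil,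
            QProg.errorProb_pure]
        · rw [add_zero]
          gcongr
          simp
      · exact hd (h ▸ hv)
    · have hval := G.value_eq_eval_arg x t v hv fun z hz => ht _ (hl.1 z hz) hz
      refine ⟨Function.update t v (G.value x v), ?_, fun u hu hd => ?_⟩
      · rw [List.reverse_cons, List.foldlM_append]
        refine (QProg.errorProb_bind_le herr (δ := G.searchError) ?_).trans ?_
        · have hgate := G.errorProb_boostedGate x hS hn t v hv
          rw [hval] at hgate
          simp only [List.foldlM_cons, List.foldlM_nil, bind_pure]
          rw [evalStep, dif_pos hv]
          refine (QProg.errorProb_bind_le hgate (δ := 0) ?_).trans (add_zero _).le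
          rw [QProg.errorProb_pure]
        · rw [List.length_cons]
          push_cast
          rw [add_mul, one_mul]
      · by_cases huv : u = v
        · simp [huv]
        · rw [Function.update_of_ne huv]
          exact ht u ((List.mem_cons.1 hu).resolve_left huv) hd

/-! ### Ordered graphs -/

omit [NeZero n] in
theorem closed_of_pairwise_lt (hord : ∀ u w, G.Edge u w → u < w) {l : List (Fin n)}
    (hl : l.Pairwise (· < ·)) (hup : ∀ v ∈ l, ∀ w, v < w → G.deg w ≠ 0 → w ∈ l) : G.Closed l := by
  induction l with
  | nil => trivial
  | cons v l ih =>
    rw [List.pairwise_cons] at hl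
    have htail : ∀ u, v ≤ u → ∀ w, u < w → G.deg w ≠ 0 → u ∈ v :: l → w ∈ l := by
      intro u hvu w huw hw hu
      refine (List.mem_cons.1 (hup u hu w huw hw)).resolve_left fun h => ?_
      exact absurd (hvu.trans_lt huw) (by rw [h]; exact lt_irrefl v)
    refine ⟨fun z hz => htail v le_rfl _ (hord _ _ ⟨z, rfl⟩) hz (by simp), ih hl.2 ?_⟩
    exact fun u hu w huw hw => htail u (hl.1 u hu).le w huw hw (by simp [hu])

omit [NeZero n] in
theorem closed_nonsinks (hord : G.IsOrdered) :
    G.Closed ((List.finRange n).filter fun v => G.deg v ≠ 0) := by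
  refine G.closed_of_pairwise_lt hord.1 ((List.pairwise_lt_finRange n).filter _) ?_
  intro v _ w _ hw
  simpa using hw

omit [NeZero n] in
theorem sum_map_nonsinks {M : Type} [AddCommMonoid M] (w : Fin n → M) :
    (((List.finRange n).filter fun v => G.deg v ≠ 0).map w).sum = ∑ u with G.deg u ≠ 0, w u := by
  rw [← List.sum_toFinset _ ((List.nodup_finRange n).filter _)]
  congr 1
  ext u
  simp

/-! ### Counting edges -/

omit [NeZero n] in
theorem edgeCount_eq_sum : G.edgeCount = ∑ u with G.deg u ≠ 0, G.deg u := by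
  rw [Finset.sum_filter_ne_zero, edgeCount]
  have : {e : Fin n × Fin n | G.Edge e.1 e.2} =
      Set.range fun p : Σ v : Fin n, Fin (G.deg v) => (p.1, G.adj p.1 p.2) := by
    ext ⟨u, w⟩
    simp only [Edge, Set.mem_ofPred_eq, Set.mem_range, Prod.mk.injEq, Sigma.exists]
    constructor
    · rintro ⟨z, rfl⟩
      exact ⟨u, z, rfl, rfl⟩
    · rintro ⟨_, z, rfl, rfl⟩
      exact ⟨z, rfl⟩
  rw [this, ← Set.image_univ, Set.ncard_image_of_injective, Set.ncard_univ,
    Nat.card_eq_fintype_card, Fintype.card_sigma]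
  · simp
  · rintro ⟨u, z⟩ ⟨w, y⟩ h
    obtain ⟨rfl, h₂⟩ := Prod.mk.inj h
    exact congrArg (Sigma.mk u) (G.adj_injective u h₂)

omit [NeZero n] in
theorem nhat_le_edgeCount : G.nhat ≤ G.edgeCount := by
  rw [edgeCount_eq_sum, nhat, Finset.card_eq_sum_ones]
  refine Finset.sum_le_sum fun u hu => ?_
  simp only [Finset.mem_filter_univ] at hu
  omega

end AndOrNotDag

/-! ### The whole algorithm -/

theorem Subroutines.Correct.mono {S : Subroutines} {C C' : ℝ} (hS : S.Correct C) (h : C ≤ C') :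
    S.Correct C' where
  gate_queries G x t v hv p hp := (hS.gate_queries G x t v hv p hp).trans (by gcongr)
  gate_error := hS.gate_error
  gate_one_sided := hS.gate_one_sided
  first_found G x visited v start hn hs z q hq := by
    obtain ⟨h₁, h₂, h₃⟩ := hS.first_found G x visited v start hn hs z q hq
    have : 0 ≤ Real.log G.nhat := Real.log_natCast_nonneg _
    exact ⟨h₁, h₂, h₃.trans (by gcongr)⟩
  first_none G x visited v start hn hs q hq := by
    have : 0 ≤ Real.log G.nhat := Real.log_natCast_nonneg _
    exact (hS.first_none G x visited v start hn hs q hq).trans (by gcongr)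
  first_error := hS.first_error

theorem List.mem_dropWhile_ne {α : Type} [DecidableEq α] {a : α} {l : List α} (h : a ∈ l) :
    a ∈ l.dropWhile fun b => b ≠ a := by
  induction l with
  | nil => simp at h
  | cons b l ih =>
    rw [List.dropWhile_cons]
    split_ifs with hb
    · exact ih ((List.mem_cons.1 h).resolve_left fun h' => by simp [h'] at hb)
    · exact h

namespace AndOrNotDag

open Subroutines Frame

variable {n N : ℕ} [NeZero n] {S : Subroutines} {C : ℝ} (G : AndOrNotDag n N)
  (x : Fin N → Bool)

/-- The computation of the order, with or without the topological sort. -/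
abbrev orderProg (S : Subroutines) (ordered : Bool) (starts : List (Fin n)) :
    G.Prog (List (Fin n)) :=
  if ordered then (pure ((List.finRange n).filter fun v => G.deg v ≠ 0) : G.Prog (List (Fin n)))
  else S.topSort G.toFrame starts

/-- Reading off the value of the root. -/
abbrev outputProg (t : Fin n → Bool) : G.Prog Bool :=
  if h : G.deg G.root = 0 then do
    let a ← QProg.read (I := G.Index) (Z := Frame.Answer n) (Sum.inr ⟨G.root, h⟩)
    pure (a.2 == 1)
  else pure (t G.root)

theorem evaluate_eq (ordered : Bool) (starts : List (Fin n)) :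
    S.evaluate G.toFrame ordered starts = G.orderProg S ordered starts >>= fun order =>
      (order.dropWhile fun v => v ≠ G.root).reverse.foldlM (G.evalStep S) (fun _ => false) >>=
        G.outputProg := by
  cases ordered <;> rfl

theorem errorProb_outputProg {t : Fin n → Bool}
    (ht : G.deg G.root ≠ 0 → t G.root = G.value x G.root) :
    (G.outputProg t).errorProb (G.oracle x) (G.value x G.root) = 0 := by
  rw [QProg.errorProb_eq_zero_iff, outputProg]
  split_ifs with hroot
  · rw [QProg.always_bind, QProg.always_read, QProg.always_pure, G.value_eq x G.root, dif_pos hroot]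
    exact bit_eq_one _
  · rw [QProg.always_pure]
    exact ht hroot

theorem always_orderProg {α β : ℝ} (hS : S.Correct C) (hn : 2 ≤ G.nhat) (hα : 0 ≤ α) (hβ : 0 ≤ β)
    (hcost : ∀ l : ℝ, 0 ≤ l → C * √l * Real.log G.nhat ≤ α * l + β) {w : Fin n → ℝ}
    (hw : ∀ v, 0 ≤ w v) (ordered : Bool) (starts : List (Fin n)) :
    (G.orderProg S ordered starts).Always (G.oracle x) fun order q =>
      (q : ℝ) ≤ ∑ u with G.deg u ≠ 0, (α * G.deg u + 2 * β + 1) ∧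
        (order.map w).sum ≤ ∑ u with G.deg u ≠ 0, w u := by
  unfold orderProg
  split_ifs
  · rw [QProg.always_pure, sum_map_nonsinks, Nat.cast_zero]
    exact ⟨by positivity, le_rfl⟩
  · exact G.always_topSort x hS hn hα hβ hcost hw starts

theorem exists_errorProb_orderProg (hS : S.Correct C) (hn : 2 ≤ G.nhat) {ordered : Bool}
    (hord : ordered = true → G.IsOrdered) {starts : List (Fin n)}
    (hstarts : ∀ v, G.IsSource v → v ∈ starts) :
    ∃ order, (G.orderProg S ordered starts).errorProb (G.oracle x) order ≤
        (2 * G.nhat : ℕ) * G.searchError ∧ G.Closed order ∧ order.length ≤ G.nhat ∧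
        ∀ v, G.deg v ≠ 0 → v ∈ order := by
  unfold orderProg
  split_ifs with h
  · refine ⟨_, ?_, G.closed_nonsinks (hord h), ?_, fun v hv => by simpa using hv⟩
    · rw [QProg.errorProb_pure]
      exact zero_le
    · have := G.sum_map_nonsinks fun _ => 1
      rw [List.map_const', List.sum_replicate, smul_eq_mul, mul_one,
        ← Finset.card_eq_sum_ones] at this
      exact this.le
  · exact G.exists_errorProb_topSort x hS hn hstarts

/-- The topological sort contributes `3/2 * C + 1` to the constant, and the evaluation `5 * C`,
since `⌈2 log₂ nhat⌉ ≤ 5 * log nhat`. -/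
theorem always_evaluate (hS : S.Correct C) (hC : 0 ≤ C) (hn : 2 ≤ G.nhat) (ordered : Bool)
    (starts : List (Fin n)) :
    (S.evaluate G.toFrame ordered starts).Always (G.oracle x) fun _ q =>
      (q : ℝ) ≤ (7 * C + 4) * (√((G.nhat : ℝ) * G.edgeCount) * Real.log G.nhat) := by
  have hm := G.nhat_le_edgeCount
  have hn' : (2 : ℝ) ≤ G.nhat := by exact_mod_cast hn
  have hm' : (G.nhat : ℝ) ≤ G.edgeCount := by exact_mod_cast hm
  set L := Real.log G.nhat with hL
  set X := √((G.nhat : ℝ) * G.edgeCount) with hX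
  have hX2 : X ^ 2 = G.nhat * G.edgeCount := Real.sq_sqrt (by positivity)
  have hX0 : 0 < X := Real.sqrt_pos.2 (by nlinarith)
  have hnX : (G.nhat : ℝ) ≤ X := Real.le_sqrt_of_sq_le (by nlinarith)
  have hL2 : 0.69 ≤ L :=
    le_trans (by linarith [Real.log_two_gt_d9]) (Real.log_le_log (by norm_num) hn')
  -- the slope `lam / 2` and the offset `1 / (2 * lam)` of a tangent of the square root
  set lam := (G.nhat : ℝ) / X with hlam
  have hlam0 : 0 < lam := by positivity
  have htan : ∀ l : ℝ, 0 ≤ l → √l ≤ lam / 2 * l + 1 / (2 * lam) := by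
    intro l hl
    have h := Real.sq_sqrt hl
    have h2 : 0 ≤ (lam * √l - 1) ^ 2 / (2 * lam) := by positivity
    have h3 : (lam * √l - 1) ^ 2 / (2 * lam) = lam / 2 * √l ^ 2 + 1 / (2 * lam) - √l := by
      field_simp
      ring
    rw [h3, h] at h2
    linarith
  have hlm : lam * G.edgeCount = X := by
    rw [hlam, div_mul_eq_mul_div, ← hX2]
    field_simp
  have hln : 1 / lam * G.nhat = X := by
    rw [hlam]
    field_simp
  have hdeg : ∑ u with G.deg u ≠ 0, (G.deg u : ℝ) = G.edgeCount := by
    rw [edgeCount_eq_sum]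
    push_cast
    rfl
  have hcard : ∀ c : ℝ, ∑ u with G.deg u ≠ 0, c = c * G.nhat := by
    intro c
    rw [Finset.sum_const, nsmul_eq_mul, mul_comm]
    rfl
  set k := ⌈2 * Real.logb 2 G.nhat⌉₊ with hk
  have hkL : (k : ℝ) ≤ 5 * L := by
    have hlb : Real.logb 2 G.nhat ≤ 1.45 * L := by
      rw [Real.logb, div_le_iff₀ (Real.log_pos (by norm_num))]
      nlinarith [Real.log_two_gt_d9]
    have := Nat.ceil_lt_add_one (show 0 ≤ 2 * Real.logb 2 G.nhat from
      mul_nonneg two_pos.le (Real.logb_nonneg (by norm_num) (by linarith)))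
    rw [← hk] at this
    linarith
  set w : Fin n → ℝ := fun v => k * (C * √(G.deg v)) with hw
  have hw0 : ∀ v, 0 ≤ w v := fun v => by positivity
  have hwsum : ∑ u with G.deg u ≠ 0, w u ≤ 5 * L * C * X := by
    have h1 : ∑ u with G.deg u ≠ 0, √(G.deg u : ℝ) ≤ X := by
      calc ∑ u with G.deg u ≠ 0, √(G.deg u : ℝ)
          ≤ ∑ u with G.deg u ≠ 0, (lam / 2 * G.deg u + 1 / (2 * lam)) :=
            Finset.sum_le_sum fun u _ => htan _ (Nat.cast_nonneg _)
        _ = (lam * G.edgeCount) / 2 + (1 / lam * G.nhat) / 2 := by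
            rw [Finset.sum_add_distrib, ← Finset.mul_sum, hdeg, hcard]
            field_simp
        _ = X := by
            rw [hlm, hln]
            ring
    rw [hw]
    simp only [← mul_assoc]
    rw [← Finset.mul_sum]
    gcongr
  have hcost : ∀ l : ℝ, 0 ≤ l →
      C * √l * L ≤ (C * L * (lam / 2)) * l + C * L * (1 / (2 * lam)) := by
    intro l hl
    have := mul_le_mul_of_nonneg_left (htan l hl) (show 0 ≤ C * L by positivity)
    linarith
  rw [evaluate_eq, QProg.always_bind]
  refine (G.always_orderProg x hS hn (by positivity) (by positivity) hcost hw0 ordered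
    starts).mono fun order q hq => ?_
  have hq₁ : (q : ℝ) ≤ C * L * X * (3 / 2) + X := by
    refine hq.1.trans ?_
    have : ∑ u with G.deg u ≠ 0,
        (C * L * (lam / 2) * G.deg u + 2 * (C * L * (1 / (2 * lam))) + 1) =
        C * L / 2 * (lam * G.edgeCount) + C * L * (1 / lam * G.nhat) + G.nhat := by
      rw [Finset.sum_add_distrib, Finset.sum_add_distrib, ← Finset.mul_sum, hdeg, hcard, hcard]
      field_simp
    rw [this, hlm, hln]
    linarith
  rw [QProg.always_bind]
  refine (G.always_evalLoop x hS hC _ _).mono fun t q₂ hq₂ => ?_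
  have hq₃ : (q₂ : ℝ) ≤ 5 * L * C * X := by
    refine hq₂.trans (le_trans ?_ (hq.2.trans hwsum))
    rw [List.map_reverse, List.sum_reverse]
    exact ((List.dropWhile_sublist _).map w).sum_le_sum fun a ha => by
      obtain ⟨v, _, rfl⟩ := List.mem_map.1 ha
      exact hw0 v
  have hfinal : ∀ q₃ : ℕ, q₃ ≤ 1 → ((q + (q₂ + q₃) : ℕ) : ℝ) ≤ (7 * C + 4) * (X * L) := by
    intro q₃ hq₃'
    have h1 : (q₃ : ℝ) ≤ 1 := by exact_mod_cast hq₃'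
    have h2 : 0 ≤ C * (X * L) := by positivity
    have h3 : 0.69 * X ≤ X * L := by nlinarith
    push_cast
    nlinarith
  unfold outputProg
  split_ifs with hroot
  · rw [QProg.always_bind, QProg.always_read, QProg.always_pure]
    exact hfinal 1 le_rfl
  · rw [QProg.always_pure]
    exact hfinal 0 zero_le_one

theorem errorProb_evaluate (hS : S.Correct C) (hn : 2 ≤ G.nhat) {ordered : Bool}
    (hord : ordered = true → G.IsOrdered) {starts : List (Fin n)}
    (hstarts : ∀ v, G.IsSource v → v ∈ starts) :
    (S.evaluate G.toFrame ordered starts).errorProb (G.oracle x) (G.value x G.root) ≤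
      ENNReal.ofReal (3 / G.nhat) := by
  obtain ⟨order, herr, hclosed, hlen, hmem⟩ := G.exists_errorProb_orderProg x hS hn hord hstarts
  obtain ⟨t, herr', ht⟩ := G.exists_errorProb_evalLoop x hS hn
    (hclosed.dropWhile fun v => v ≠ G.root)
  have hlen' : ((order.dropWhile fun v => v ≠ G.root).length : ℝ≥0∞) ≤ G.nhat := by
    exact_mod_cast (List.dropWhile_sublist _).length_le.trans hlen
  rw [evaluate_eq]
  refine (QProg.errorProb_bind_le herr (δ := G.nhat * G.searchError) ?_).trans ?_
  · refine (QProg.errorProb_bind_le herr' (δ := 0) ?_).trans ?_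
    · exact (G.errorProb_outputProg x fun hroot =>
        ht G.root (List.mem_dropWhile_ne (hmem _ hroot)) hroot).le
    · rw [add_zero]
      gcongr
  · rw [← add_mul, ← Nat.cast_add, searchError, ← ENNReal.ofReal_natCast,
      ← ENNReal.ofReal_mul (by positivity)]
    refine ENNReal.ofReal_le_ofReal (le_of_eq ?_)
    have : (G.nhat : ℝ) ≠ 0 := by
      have : 0 < G.nhat := by omega
      positivity
    push_cast
    field_simp
    ring

end AndOrNotDag

theorem theorem1 :
    (∃ C₀ : ℝ, ∃ S : Subroutines, S.Correct C₀) ∧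
    ∀ C₀ : ℝ, ∃ C : ℝ, ∀ S : Subroutines, S.Correct C₀ →
      ∀ (n N : ℕ) [NeZero n] (G : AndOrNotDag n N) (x : Fin N → Bool)
        (ordered : Bool) (starts : List (Fin n)),
        2 ≤ G.nhat →
        (ordered = true → G.IsOrdered) →
        (∀ v, G.IsSource v → v ∈ starts) →
        (∀ p ∈ ((S.evaluate G.toFrame ordered starts).run (G.oracle x)).support,
          (p.2 : ℝ) ≤ C * (√((G.nhat : ℝ) * G.edgeCount) * Real.log G.nhat) ∧
          (p.2 : ℝ) ≤ C * (√((n : ℝ) * G.edgeCount) * Real.log n)) ∧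
        (S.evaluate G.toFrame ordered starts).errorProb (G.oracle x) (G.value x G.root) ≤
          ENNReal.ofReal (C / G.nhat) := by
  refine ⟨⟨_, _, groverSubroutines_correct⟩, fun C₀ => ⟨7 * max C₀ 0 + 4, ?_⟩⟩
  intro S hS n N _ G x ordered starts hn hord hstarts
  have hC : 0 ≤ max C₀ 0 := le_max_right _ _
  have hS' := hS.mono (le_max_left C₀ 0)
  refine ⟨fun p hp => ?_, ?_⟩
  · have hq := G.always_evaluate x hS' hC hn ordered starts p hp
    refine ⟨hq, hq.trans ?_⟩
    have hle : (G.nhat : ℝ) ≤ n := by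
      exact_mod_cast (Finset.card_le_univ _).trans_eq (Fintype.card_fin n)
    have h0 : (0 : ℝ) < G.nhat := by
      have : 0 < G.nhat := by omega
      positivity
    have : 0 ≤ Real.log G.nhat := Real.log_natCast_nonneg _
    gcongr
  · refine (G.errorProb_evaluate x hS' hn hord hstarts).trans (ENNReal.ofReal_le_ofReal ?_)
    gcongr
    linarith

end
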